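/- All graphs are finite, simple and undirected. A graph is chordal if every cycle of length greater than three has a chord, i.e. an edge between two non-consecutive vertices of the cycle; it is $K_p$-free if it has no induced subgraph isomorphic to the complete graph $K_p$ on $p$ vertices. **Theorem.** For every fixed integer $p > 1$, the chordal $\rightarrow$ $K_p$-free vertex deletion problem is in P: there is a Turing machine which, given (the adjacency matrix of) any chordal graph $G$, outputs, in time polynomial in the size of the input, a set $V_- \subseteq V(G)$ of minimum cardinality such that $G - V_-$ is $K_p$-free. -/

import Mathlib

namespace VertexDeletion

/-- A graph class, given as a property of simple graphs. -/
abbrev GraphClass : Type 1 := ∀ ⦃V : Type⦄, SimpleGraph V → Prop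

/-- The class of chordal graphs: every cycle of length larger than three has a chord, that is, an
edge of the graph that joins two vertices of the cycle and is not an edge of the cycle. -/
def Chordal : GraphClass := fun V G =>
  ∀ (v : V) (c : G.Walk v v), c.IsCycle → 3 < c.length →
    ∃ a ∈ c.support, ∃ b ∈ c.support, G.Adj a b ∧ s(a, b) ∉ c.edges

/-- The class of `F`-free graphs: graphs in which no induced subgraph is isomorphic to `F`. -/
def InducedFree {W : Type} (F : SimpleGraph W) : GraphClass := fun _ G => ¬ F.IsIndContained G

/-- A finite graph (on the vertices `0, …, n - 1` for some `n`) that belongs to the class `C`. -/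
structure Instance (C : GraphClass) where
  n : ℕ
  graph : SimpleGraph (Fin n)
  mem : C graph

/-- Deleting the vertex set `S` from `G` leaves a graph in the class `C`. -/
def IsDeletionSet (C : GraphClass) {n : ℕ} (G : SimpleGraph (Fin n)) (S : Finset (Fin n)) : Prop :=
  C (G.induce {v | v ∉ S})

/-- `S` has minimum cardinality among the vertex sets whose deletion leaves a graph in `C`. -/
def IsMinimumDeletionSet (C : GraphClass) {n : ℕ} (G : SimpleGraph (Fin n))
    (S : Finset (Fin n)) : Prop :=
  IsDeletionSet C G S ∧ ∀ T : Finset (Fin n), IsDeletionSet C G T → S.card ≤ T.card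

open Classical in
/-- The adjacency matrix, written row by row as a string of `n ^ 2` bits. -/
noncomputable def encodeGraph {n : ℕ} (G : SimpleGraph (Fin n)) : List Bool :=
  (List.finRange n).flatMap fun i => (List.finRange n).map fun j => decide (G.Adj i j)

/-- A set of vertices, written as a string of `n` bits. -/
def encodeVertexSet {n : ℕ} (S : Finset (Fin n)) : List Bool :=
  (List.finRange n).map fun i => decide (i ∈ S)

/-- The vertex deletion problem from `C₁` to `C₂` is in P: some Turing machine, given the
adjacency matrix of any finite graph `G` in `C₁`, outputs a minimum set of vertices whose deletion
from `G` leaves a graph in `C₂`, within a number of steps that is polynomial in the input length. -/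
def DeletionProblemInP (C₁ C₂ : GraphClass) : Prop :=
  ∃ sol : (x : Instance C₁) → Finset (Fin x.n),
    (∀ x, IsMinimumDeletionSet C₂ x.graph (sol x)) ∧
    Nonempty (Turing.TM2ComputableInPolyTime
      (fun x : Instance C₁ => encodeGraph x.graph) (id : List Bool → List Bool)
      (fun x => encodeVertexSet (sol x)))

end VertexDeletion

/-!
A largest `K_{q+1}`-free set of vertices of a chordal graph can be found by dynamic programming
along a perfect elimination ordering, and its complement is a minimum deletion set.

*Simplicial vertices.* Every nonempty set of vertices of a chordal graph contains a vertex whose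
neighbours in that set form a clique (`Chordal.exists_simplicial`). This is Dirac's theorem. It is
proved by induction, in the form that a vertex which is not adjacent to all others has a simplicial
vertex among its non-neighbours: for a component `C` of the graph without the closed neighbourhood
of `v`, the neighbours of `C` form a clique, since otherwise a shortest path through `C` closes up
with `v` to a cycle without chords (`Chordal.adj_of_reachable`).

*Elimination.* The algorithm eliminates simplicial vertices one after the other. While the vertices
in `R` are left, it stores a list of factors, each of which is a table of partial solutions on some
of the eliminated vertices. The table is indexed by the part of a clique of `R`, the scope, that is
kept. The invariant (`Invariant`) says that for every `K_{q+1}`-free `X ⊆ R`, the union of the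
entries for `X` is a best way to extend `X` by eliminated vertices. When `v` is eliminated, the
factors with `v` in their scope are merged into one, whose scope is the set of neighbours of `v` in
`R`; its entry for `X` is the better one of the solutions in which `v` is deleted and kept. Keeping
`v` is allowed if and only if `X` has fewer than `q` vertices in the new scope, since a clique of
`X ∪ {v}` that contains `v` consists of `v` and vertices of the scope. As scopes are cliques, only
their subsets with at most `q` elements matter, so that the tables have polynomial size for fixed
`q` (`isBestExtension_solve`).

*Turing machines.* Structured programs on four stacks of bits are compiled to Turing machines that
simulate them step by step (`Run.steps`). All data is encoded by binary trees, written on a stack in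
preorder. The functions between such data that are computed by stack programs in polynomial time
(`PolyTime`) contain the usual operations on pairs, lists and unary numbers and are closed under
composition and under folding over lists, as long as the intermediate results have polynomial size
(`PolyTime.foldl`). For the main loop of the algorithm this size bound is
`StateBounded.size_le`.
-/

namespace StackProgram

/-! ### Structured stack programs and their compilation to Turing machines -/

/-- The four stacks of the machines: `main` holds the data, the other three are scratch space. -/
inductive Stk
  | main | aux₁ | aux₂ | cnt
  deriving DecidableEq

instance : Fintype Stk := ⟨{.main, .aux₁, .aux₂, .cnt}, by rintro ⟨⟩ <;> simp⟩

/-- The contents of all stacks. -/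
abbrev Store : Type := Stk → List Bool

/-- Structured programs over the four stacks. -/
inductive Prog
  /-- Do nothing. -/
  | skip
  /-- Push a bit. -/
  | push (k : Stk) (b : Bool)
  /-- Run two programs one after the other. -/
  | seq (p q : Prog)
  /-- Pop a stack, and run `p` if the bit was `true`, `q` if it was `false`. -/
  | popCase (k : Stk) (p q : Prog)
  /-- Pop a stack and run `p`, as long as the popped bit is `true`; a `false` that ends the loop is
  removed as well. -/
  | whileTrue (k : Stk) (p : Prog)
  /-- Pop a stack until it is empty, running `p` after each `true` and `q` after each `false`. -/
  | drain (k : Stk) (p q : Prog)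

open Prog Function

/-- `Run p s s' t`: started on the store `s`, the program `p` ends on the store `s'` after exactly
`t` steps. Popping an empty stack by `popCase` is not covered; the programs below never do it. -/
inductive Run : Prog → Store → Store → ℕ → Prop
  | skip (s) : Run skip s s 1
  | push (k b s) : Run (push k b) s (update s k (b :: s k)) 1
  | seq {p q s s' s'' t t'} : Run p s s' t → Run q s' s'' t' → Run (seq p q) s s'' (t + t')
  | pop_true {k p q s s' t l} : s k = true :: l → Run p (update s k l) s' t →
      Run (popCase k p q) s s' (1 + t)
  | pop_false {k p q s s' t l} : s k = false :: l → Run q (update s k l) s' t →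
      Run (popCase k p q) s s' (1 + t)
  | while_true {k p s s' s'' t t' l} : s k = true :: l → Run p (update s k l) s' t →
      Run (whileTrue k p) s' s'' t' → Run (whileTrue k p) s s'' (1 + (t + t'))
  | while_false {k p s l} : s k = false :: l → Run (whileTrue k p) s (update s k l) 1
  | while_nil {k p s} : s k = [] → Run (whileTrue k p) s s 1
  | drain_true {k p q s s' s'' t t' l} : s k = true :: l → Run p (update s k l) s' t →
      Run (drain k p q) s' s'' t' → Run (drain k p q) s s'' (1 + (t + t'))
  | drain_false {k p q s s' s'' t t' l} : s k = false :: l → Run q (update s k l) s' t →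
      Run (drain k p q) s' s'' t' → Run (drain k p q) s s'' (1 + (t + t'))
  | drain_nil {k p q s} : s k = [] → Run (drain k p q) s s 1

/-- The program points of a program. -/
def Lab : Prog → Type
  | skip => Unit
  | push _ _ => Unit
  | seq p q => Lab p ⊕ Lab q
  | popCase _ p q => Option (Lab p ⊕ Lab q)
  | whileTrue _ p => Option (Lab p)
  | drain _ p q => Option (Lab p ⊕ Lab q)

/-- The first program point of a program. -/
def entry : (p : Prog) → Lab p
  | skip => ()
  | push _ _ => ()
  | seq p _ => Sum.inl (entry p)
  | popCase _ _ _ => none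
  | whileTrue _ _ => none
  | drain _ _ _ => none

instance instFintypeLab : (p : Prog) → Fintype (Lab p)
  | skip => inferInstanceAs (Fintype Unit)
  | push _ _ => inferInstanceAs (Fintype Unit)
  | seq p q =>
    letI := instFintypeLab p
    letI := instFintypeLab q
    inferInstanceAs (Fintype (Lab p ⊕ Lab q))
  | popCase _ p q =>
    letI := instFintypeLab p
    letI := instFintypeLab q
    inferInstanceAs (Fintype (Option (Lab p ⊕ Lab q)))
  | whileTrue _ p =>
    letI := instFintypeLab p
    inferInstanceAs (Fintype (Option (Lab p)))
  | drain _ p q =>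
    letI := instFintypeLab p
    letI := instFintypeLab q
    inferInstanceAs (Fintype (Option (Lab p ⊕ Lab q)))

/-- Machine statements; the internal state is the bit that was popped last. -/
abbrev Stmt (Λ : Type) : Type := Turing.TM2.Stmt (fun _ : Stk => Bool) Λ (Option Bool)

/-- The machine code of a program that is placed at the labels `emb l` of a larger machine and
jumps to the label `exit` when it is done. -/
def code {Λ : Type} : (p : Prog) → (emb : Lab p → Λ) → (exit : Λ) → Lab p → Stmt Λ
  | skip, _, exit, _ => .goto fun _ => exit
  | push k b, _, exit, _ => .push k (fun _ => b) (.goto fun _ => exit)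
  | seq p q, emb, exit, l => match l with
    | .inl l => code p (fun x => emb (.inl x)) (emb (.inr (entry q))) l
    | .inr l => code q (fun x => emb (.inr x)) exit l
  | popCase k p q, emb, exit, l => match l with
    | none => .pop k (fun _ o => o) (.goto fun o =>
        if o = some true then emb (some (.inl (entry p))) else emb (some (.inr (entry q))))
    | some (.inl l) => code p (fun x => emb (some (.inl x))) exit l
    | some (.inr l) => code q (fun x => emb (some (.inr x))) exit l
  | whileTrue k p, emb, exit, l => match l with
    | none => .pop k (fun _ o => o) (.goto fun o =>
        if o = some true then emb (some (entry p)) else exit)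
    | some l => code p (fun x => emb (some x)) (emb none) l
  | drain k p q, emb, exit, l => match l with
    | none => .pop k (fun _ o => o) (.goto fun o => match o with
        | some true => emb (some (.inl (entry p)))
        | some false => emb (some (.inr (entry q)))
        | none => exit)
    | some (.inl l) => code p (fun x => emb (some (.inl x))) (emb none) l
    | some (.inr l) => code q (fun x => emb (some (.inr x))) (emb none) l

section Simulation

variable {Λ : Type} (M : Λ → Stmt Λ)

/-- `t` steps of the machine `M` lead from the configuration `c` to the configuration `c'`. -/
def Steps (t : ℕ) (c c' : Turing.TM2.Cfg (fun _ : Stk => Bool) Λ (Option Bool)) : Prop :=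
  (flip bind (Turing.TM2.step M))^[t] (some c) = some c'

variable {M}

theorem Steps.trans {t t' : ℕ} {c c' c''} (h : Steps M t c c') (h' : Steps M t' c' c'') :
    Steps M (t + t') c c'' := by
  unfold Steps at *
  rw [Nat.add_comm, iterate_add_apply, h, h']

theorem steps_one {c c'} (h : Turing.TM2.step M c = some c') : Steps M 1 c c' := h

theorem step_entry {p : Prog} {emb : Lab p → Λ} {exit : Λ}
    (hM : ∀ l, M (emb l) = code p emb exit l) (v : Option Bool) (s : Store) :
    Turing.TM2.step M ⟨some (emb (entry p)), v, s⟩ =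
      some (Turing.TM2.stepAux (code p emb exit (entry p)) v s) := by
  rw [← hM]
  rfl

/-- The machine code of a program simulates its runs step by step. -/
theorem Run.steps {p : Prog} {s s' : Store} {t : ℕ} (h : Run p s s' t) :
    ∀ (emb : Lab p → Λ) (exit : Λ), (∀ l, M (emb l) = code p emb exit l) → ∀ v,
      ∃ v', Steps M t ⟨some (emb (entry p)), v, s⟩ ⟨some exit, v', s'⟩ := by
  induction h with
  | skip s =>
    intro emb exit hM v
    refine ⟨v, steps_one ?_⟩
    rw [step_entry hM]
    simp [code, Turing.TM2.stepAux]
  | push k b s =>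
    intro emb exit hM v
    refine ⟨v, steps_one ?_⟩
    rw [step_entry hM]
    simp [code, Turing.TM2.stepAux]
  | seq _ _ ih ih' =>
    intro emb exit hM v
    obtain ⟨v₁, h₁⟩ := ih (fun x => emb (.inl x)) _ (fun l => hM (.inl l)) v
    obtain ⟨v₂, h₂⟩ := ih' (fun x => emb (.inr x)) exit (fun l => hM (.inr l)) v₁
    exact ⟨v₂, h₁.trans h₂⟩
  | pop_true hk _ ih =>
    intro emb exit hM v
    obtain ⟨v₁, h₁⟩ := ih (fun x => emb (some (.inl x))) exit (fun l => hM (some (.inl l)))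
      (some true)
    refine ⟨v₁, Steps.trans (steps_one ?_) h₁⟩
    rw [step_entry hM]
    simp [entry, code, Turing.TM2.stepAux, hk]
  | pop_false hk _ ih =>
    intro emb exit hM v
    obtain ⟨v₁, h₁⟩ := ih (fun x => emb (some (.inr x))) exit (fun l => hM (some (.inr l)))
      (some false)
    refine ⟨v₁, Steps.trans (steps_one ?_) h₁⟩
    rw [step_entry hM]
    simp [entry, code, Turing.TM2.stepAux, hk]
  | while_true hk _ _ ih ih' =>
    intro emb exit hM v
    obtain ⟨v₁, h₁⟩ := ih (fun x => emb (some x)) _ (fun l => hM (some l)) (some true)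
    obtain ⟨v₂, h₂⟩ := ih' emb exit hM v₁
    refine ⟨v₂, Steps.trans (steps_one ?_) (h₁.trans h₂)⟩
    rw [step_entry hM]
    simp [entry, code, Turing.TM2.stepAux, hk]
  | while_false hk =>
    intro emb exit hM v
    refine ⟨some false, steps_one ?_⟩
    rw [step_entry hM]
    simp [entry, code, Turing.TM2.stepAux, hk]
  | while_nil hk =>
    intro emb exit hM v
    refine ⟨none, steps_one ?_⟩
    rw [step_entry hM]
    simp [entry, code, Turing.TM2.stepAux, hk]
  | drain_true hk _ _ ih ih' =>
    intro emb exit hM v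
    obtain ⟨v₁, h₁⟩ := ih (fun x => emb (some (.inl x))) _ (fun l => hM (some (.inl l)))
      (some true)
    obtain ⟨v₂, h₂⟩ := ih' emb exit hM v₁
    refine ⟨v₂, Steps.trans (steps_one ?_) (h₁.trans h₂)⟩
    rw [step_entry hM]
    simp [entry, code, Turing.TM2.stepAux, hk]
  | drain_false hk _ _ ih ih' =>
    intro emb exit hM v
    obtain ⟨v₁, h₁⟩ := ih (fun x => emb (some (.inr x))) _ (fun l => hM (some (.inr l)))
      (some false)
    obtain ⟨v₂, h₂⟩ := ih' emb exit hM v₁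
    refine ⟨v₂, Steps.trans (steps_one ?_) (h₁.trans h₂)⟩
    rw [step_entry hM]
    simp [entry, code, Turing.TM2.stepAux, hk]
  | drain_nil hk =>
    intro emb exit hM v
    refine ⟨none, steps_one ?_⟩
    rw [step_entry hM]
    simp [entry, code, Turing.TM2.stepAux, hk]

end Simulation

/-- The Turing machine that runs a program, with input and output on the stack `main`; the extra
label `none` resets the internal state and halts. -/
def machine (p : Prog) : Turing.FinTM2 where
  k₀ := Stk.main
  k₁ := Stk.main
  Γ := fun _ : Stk => Bool
  Λ := Option (Lab p)
  main := some (entry p)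
  σ := Option Bool
  initialState := none
  Γk₀Fin := inferInstanceAs (Fintype Bool)
  m
    | some l => code p some none l
    | none => .load (fun _ => none) .halt

/-- The store with the given contents of `main`, `aux₁`, `aux₂` and `cnt`. -/
def st (m a b c : List Bool) : Store
  | .main => m
  | .aux₁ => a
  | .aux₂ => b
  | .cnt => c

/-- A program that turns the input into the output on `main`, in polynomially many steps and leaving
the other stacks empty, gives a polynomial time Turing machine. -/
theorem polyTime_of_run {α : Type} {ea : α → List Bool} {f : α → List Bool} (p : Prog)
    (P : Polynomial ℕ)
    (h : ∀ a, ∃ t ≤ P.eval (ea a).length, Run p (st (ea a) [] [] []) (st (f a) [] [] []) t) :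
    Nonempty (Turing.TM2ComputableInPolyTime ea (id : List Bool → List Bool) f) := by
  have key : ∀ a, ∃ t, t ≤ (P + 1).eval (ea a).length ∧
      Steps (machine p).m t (Turing.initList (machine p) (ea a))
        (Turing.haltList (machine p) (f a)) := by
    intro a
    obtain ⟨t, ht, hr⟩ := h a
    obtain ⟨v, hv⟩ := hr.steps (M := (machine p).m) some none (fun _ => rfl) none
    refine ⟨t + 1, by simpa using ht, ?_⟩
    have h1 : Turing.initList (machine p) (ea a) =
        ⟨some (some (entry p)), none, st (ea a) [] [] []⟩ := by
      unfold Turing.initList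
      congr 1
      funext k
      cases k <;> rfl
    have h2 : Turing.haltList (machine p) (f a) = ⟨none, none, st (f a) [] [] []⟩ := by
      unfold Turing.haltList
      congr 1
      funext k
      cases k <;> rfl
    rw [h1, h2]
    exact hv.trans (steps_one rfl)
  choose t ht hs using key
  exact ⟨{
    tm := machine p
    inputAlphabet := Equiv.refl _
    outputAlphabet := Equiv.refl _
    time := P + 1
    outputsFun := fun a => {
      steps := t a
      evals_in_steps := by
        have hid : ∀ l : List Bool, List.map (Equiv.refl Bool).invFun l = l := List.map_id
        refine Eq.trans ?_ (Eq.trans (hs a) ?_)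
        · exact congrArg (fun l => (flip bind (machine p).step)^[t a]
            (some (Turing.initList (machine p) l))) (hid (ea a))
        · exact congrArg (fun l => some (Turing.haltList (machine p) l)) (hid (f a)).symm
      steps_le_m := ht a } }⟩

end StackProgram

namespace StackProgram

open Prog Function

/-! ### Serialized trees on a stack -/

/-- Binary trees with unlabelled leaves, the universal data type of the stack programs. -/
inductive SExp
  | nil
  | cons (x y : SExp)

/-- The preorder traversal of a tree, `true` standing for an inner node and `false` for a leaf. It
is self-delimiting, so that trees can be written one after the other on a stack. -/
def SExp.ser : SExp → List Bool
  | nil => [false]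
  | cons x y => true :: (x.ser ++ y.ser)

@[simp] theorem st_main (m a b c : List Bool) : st m a b c .main = m := rfl
@[simp] theorem st_aux₁ (m a b c : List Bool) : st m a b c .aux₁ = a := rfl
@[simp] theorem st_aux₂ (m a b c : List Bool) : st m a b c .aux₂ = b := rfl
@[simp] theorem st_cnt (m a b c : List Bool) : st m a b c .cnt = c := rfl

@[simp] theorem update_main (m a b c x : List Bool) : update (st m a b c) .main x = st x a b c := by
  funext k; cases k <;> rfl
@[simp] theorem update_aux₁ (m a b c x : List Bool) : update (st m a b c) .aux₁ x = st m x b c := by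
  funext k; cases k <;> rfl
@[simp] theorem update_aux₂ (m a b c x : List Bool) : update (st m a b c) .aux₂ x = st m a x c := by
  funext k; cases k <;> rfl
@[simp] theorem update_cnt (m a b c x : List Bool) : update (st m a b c) .cnt x = st m a b x := by
  funext k; cases k <;> rfl

theorem run_push_main (v : Bool) (m a b c : List Bool) :
    Run (push .main v) (st m a b c) (st (v :: m) a b c) 1 := by
  simpa using Run.push .main v (st m a b c)

theorem run_push_aux₁ (v : Bool) (m a b c : List Bool) :
    Run (push .aux₁ v) (st m a b c) (st m (v :: a) b c) 1 := by
  simpa using Run.push .aux₁ v (st m a b c)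

theorem run_push_aux₂ (v : Bool) (m a b c : List Bool) :
    Run (push .aux₂ v) (st m a b c) (st m a (v :: b) c) 1 := by
  simpa using Run.push .aux₂ v (st m a b c)

theorem run_push_cnt (v : Bool) (m a b c : List Bool) :
    Run (push .cnt v) (st m a b c) (st m a b (v :: c)) 1 := by
  simpa using Run.push .cnt v (st m a b c)

/-- Pop the top tree of `main`, running `p` for each `true` and `q` for each `false`. The height of
the stack `cnt` is the number of trees that are still to be read. -/
def scan (p q : Prog) : Prog :=
  seq (push .cnt true) <| whileTrue .cnt <|
    popCase .main (seq p (seq (push .cnt true) (push .cnt true))) q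

/-- The effect of `scan`, when `p` and `q` record the bits on the scratch stacks: `A w` and `B w`
are the contents of these stacks when the bits in `w` have been read, latest bit first. -/
theorem run_scan {p q : Prog} {A B : List Bool → List Bool}
    (hp : ∀ m w c, Run p (st m (A w) (B w) c) (st m (A (true :: w)) (B (true :: w)) c) 1)
    (hq : ∀ m w c, Run q (st m (A w) (B w) c) (st m (A (false :: w)) (B (false :: w)) c) 1)
    (x : SExp) (r : List Bool) :
    ∃ t ≤ 5 * x.ser.length + 2, Run (scan p q) (st (x.ser ++ r) (A []) (B []) [])
      (st r (A x.ser.reverse) (B x.ser.reverse) []) t := by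
  have key : ∀ (x : SExp) (r w c : List Bool) (s' : Store) (t : ℕ),
      Run (whileTrue .cnt (popCase .main (seq p (seq (push .cnt true) (push .cnt true))) q))
        (st r (A (x.ser.reverse ++ w)) (B (x.ser.reverse ++ w)) c) s' t →
      ∃ t' ≤ 5 * x.ser.length + t,
      Run (whileTrue .cnt (popCase .main (seq p (seq (push .cnt true) (push .cnt true))) q))
        (st (x.ser ++ r) (A w) (B w) (true :: c)) s' t' := by
    intro x
    induction x with
    | nil =>
      intro r w c s' t h
      refine ⟨1 + ((1 + 1) + t), by simp [SExp.ser]; omega, ?_⟩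
      refine Run.while_true (l := c) (by simp) ?_ h
      rw [update_cnt]
      refine Run.pop_false (l := r) (by simp [SExp.ser]) ?_
      rw [update_main]
      exact hq _ _ _
    | cons x y ihx ihy =>
      intro r w c s' t h
      obtain ⟨t₁, ht₁, h₁⟩ := ihy r (x.ser.reverse ++ (true :: w)) c s' t
        (by simpa [SExp.ser] using h)
      obtain ⟨t₂, ht₂, h₂⟩ := ihx (y.ser ++ r) (true :: w) (true :: c) s' t₁ h₁
      refine ⟨1 + ((1 + (1 + (1 + 1))) + t₂), by simp [SExp.ser]; omega, ?_⟩
      refine Run.while_true (l := c) (by simp) ?_ h₂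
      rw [update_cnt]
      refine Run.pop_true (l := x.ser ++ (y.ser ++ r)) (by simp [SExp.ser]) ?_
      rw [update_main]
      exact (hp _ _ _).seq ((run_push_cnt _ _ _ _ _).seq (run_push_cnt _ _ _ _ _))
  obtain ⟨t, ht, h⟩ := key x r [] [] _ 1 (Run.while_nil (by simp))
  refine ⟨1 + t, by omega, (run_push_cnt _ _ _ _ _).seq ?_⟩
  simpa using h

/-- The effect of `drain`, when `p` and `q` record the bits elsewhere: `S w l` is the store when `l`
is left on the stack `k` and the bits in `w` have been read, latest bit first. -/
theorem run_drain {k : Stk} {p q : Prog} {S : List Bool → List Bool → Store}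
    (hk : ∀ w l, S w l k = l) (hu : ∀ w l l', update (S w l) k l' = S w l')
    (hp : ∀ w l, ∃ t ≤ 4, Run p (S w l) (S (true :: w) l) t)
    (hq : ∀ w l, ∃ t ≤ 4, Run q (S w l) (S (false :: w) l) t)
    (l : List Bool) : ∀ w, ∃ t ≤ 5 * l.length + 1,
      Run (drain k p q) (S w l) (S (l.reverse ++ w) []) t := by
  induction l with
  | nil => exact fun w => ⟨1, by simp, Run.drain_nil (hk _ _)⟩
  | cons v l ih =>
    intro w
    cases v with
    | false =>
      obtain ⟨t, ht, h⟩ := ih (false :: w)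
      obtain ⟨t', ht', h'⟩ := hq w l
      refine ⟨1 + (t' + t), by simp; omega, ?_⟩
      rw [List.reverse_cons, List.append_assoc]
      refine Run.drain_false (l := l) (hk _ _) ?_ h
      rwa [hu]
    | true =>
      obtain ⟨t, ht, h⟩ := ih (true :: w)
      obtain ⟨t', ht', h'⟩ := hp w l
      refine ⟨1 + (t' + t), by simp; omega, ?_⟩
      rw [List.reverse_cons, List.append_assoc]
      refine Run.drain_true (l := l) (hk _ _) ?_ h
      rwa [hu]

/-- Move the contents of `k`, reversed, to `k'`. -/
def move (k k' : Stk) : Prog := drain k (push k' true) (push k' false)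

theorem run_move_aux₁_main (m a b c : List Bool) :
    ∃ t ≤ 5 * a.length + 1, Run (move .aux₁ .main) (st m a b c) (st (a.reverse ++ m) [] b c) t :=
  run_drain (S := fun w l => st w l b c) (by simp) (by simp)
    (fun _ _ => ⟨1, by simp, run_push_main _ _ _ _ _⟩)
    (fun _ _ => ⟨1, by simp, run_push_main _ _ _ _ _⟩) a m

theorem run_move_aux₂_main (m a b c : List Bool) :
    ∃ t ≤ 5 * b.length + 1, Run (move .aux₂ .main) (st m a b c) (st (b.reverse ++ m) a [] c) t :=
  run_drain (S := fun w l => st w a l c) (by simp) (by simp)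
    (fun _ _ => ⟨1, by simp, run_push_main _ _ _ _ _⟩)
    (fun _ _ => ⟨1, by simp, run_push_main _ _ _ _ _⟩) b m

theorem run_move_aux₂_aux₁ (m a b c : List Bool) :
    ∃ t ≤ 5 * b.length + 1, Run (move .aux₂ .aux₁) (st m a b c) (st m (b.reverse ++ a) [] c) t :=
  run_drain (S := fun w l => st m w l c) (by simp) (by simp)
    (fun _ _ => ⟨1, by simp, run_push_aux₁ _ _ _ _ _⟩)
    (fun _ _ => ⟨1, by simp, run_push_aux₁ _ _ _ _ _⟩) b a

theorem run_move_main_aux₁ (m a b c : List Bool) :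
    ∃ t ≤ 5 * m.length + 1, Run (move .main .aux₁) (st m a b c) (st [] (m.reverse ++ a) b c) t :=
  run_drain (S := fun w l => st l w b c) (by simp) (by simp)
    (fun _ _ => ⟨1, by simp, run_push_aux₁ _ _ _ _ _⟩)
    (fun _ _ => ⟨1, by simp, run_push_aux₁ _ _ _ _ _⟩) m a

/-- `Exec p x y n`: within `n` steps, the program `p` replaces `x` by `y` at the top of `main`,
whatever is below, and it leaves the other stacks empty. -/
def Exec (p : Prog) (x y : List Bool) (n : ℕ) : Prop :=
  ∀ r, ∃ t ≤ n, Run p (st (x ++ r) [] [] []) (st (y ++ r) [] [] []) t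

theorem Exec.mono {p x y n n'} (h : Exec p x y n) (hn : n ≤ n') : Exec p x y n' := fun r =>
  let ⟨t, ht, hr⟩ := h r
  ⟨t, ht.trans hn, hr⟩

theorem Exec.seq {p q x y z n n'} (h : Exec p x y n) (h' : Exec q y z n') :
    Exec (p.seq q) x z (n + n') := fun r =>
  let ⟨t, ht, hr⟩ := h r
  let ⟨t', ht', hr'⟩ := h' r
  ⟨t + t', by omega, hr.seq hr'⟩

theorem Exec.frame {p x y n} (h : Exec p x y n) (w : List Bool) :
    Exec p (x ++ w) (y ++ w) n := fun r => by
  simpa using h (w ++ r)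

theorem exec_skip (x : List Bool) : Exec skip x x 1 := fun _ => ⟨1, le_rfl, Run.skip _⟩

theorem exec_push (v : Bool) (x : List Bool) : Exec (push .main v) x (v :: x) 1 := fun _ =>
  ⟨1, le_rfl, run_push_main _ _ _ _ _⟩

theorem Exec.popCase_true {p q x y n} (h : Exec p x y n) :
    Exec (popCase .main p q) (true :: x) y (1 + n) := fun r =>
  let ⟨t, ht, hr⟩ := h r
  ⟨1 + t, by omega, Run.pop_true (l := x ++ r) (by simp) (by simpa using hr)⟩

theorem Exec.popCase_false {p q x y n} (h : Exec q x y n) :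
    Exec (popCase .main p q) (false :: x) y (1 + n) := fun r =>
  let ⟨t, ht, hr⟩ := h r
  ⟨1 + t, by omega, Run.pop_false (l := x ++ r) (by simp) (by simpa using hr)⟩

theorem Exec.whileTrue_true {p x y z n n'} (h : Exec p x y n)
    (h' : Exec (whileTrue .main p) y z n') :
    Exec (whileTrue .main p) (true :: x) z (1 + (n + n')) := fun r =>
  let ⟨t, ht, hr⟩ := h r
  let ⟨t', ht', hr'⟩ := h' r
  ⟨1 + (t + t'), by omega, Run.while_true (l := x ++ r) (by simp) (by simpa using hr) hr'⟩

theorem exec_whileTrue_false (p : Prog) (x : List Bool) :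
    Exec (whileTrue .main p) (false :: x) x 1 := fun r =>
  ⟨1, le_rfl, by
    simpa using Run.while_false (k := .main) (p := p) (s := st (false :: x ++ r) [] [] [])
      (l := x ++ r) (by simp)⟩

/-- Remove the top bit. -/
def pop : Prog := popCase .main skip skip

theorem exec_pop (v : Bool) (x : List Bool) : Exec pop (v :: x) x 2 := by
  cases v
  · exact (exec_skip x).popCase_false
  · exact (exec_skip x).popCase_true

/-- Remove the top tree. -/
def drop : Prog := scan skip skip

theorem exec_drop (x : SExp) (w : List Bool) : Exec drop (x.ser ++ w) w (5 * x.ser.length + 2) :=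
  fun r => by
  have := run_scan (p := skip) (q := skip) (A := fun _ => []) (B := fun _ => [])
    (fun _ _ _ => Run.skip _) (fun _ _ _ => Run.skip _) x (w ++ r)
  simpa [drop] using this

/-- Move the top tree, reversed, to `aux₁`. -/
def toAux₁ : Prog := scan (push .aux₁ true) (push .aux₁ false)

theorem run_toAux₁ (x : SExp) (r : List Bool) :
    ∃ t ≤ 5 * x.ser.length + 2,
      Run toAux₁ (st (x.ser ++ r) [] [] []) (st r x.ser.reverse [] []) t :=
  run_scan (A := fun w => w) (B := fun _ => []) (fun _ _ _ => run_push_aux₁ _ _ _ _ _)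
    (fun _ _ _ => run_push_aux₁ _ _ _ _ _) x r

/-- Move the top tree, reversed, to `aux₂`. -/
def toAux₂ : Prog := scan (push .aux₂ true) (push .aux₂ false)

theorem run_toAux₂ (x : SExp) (r a : List Bool) :
    ∃ t ≤ 5 * x.ser.length + 2,
      Run toAux₂ (st (x.ser ++ r) a [] []) (st r a x.ser.reverse []) t :=
  run_scan (A := fun _ => a) (B := fun w => w) (fun _ _ _ => run_push_aux₂ _ _ _ _ _)
    (fun _ _ _ => run_push_aux₂ _ _ _ _ _) x r

/-- Exchange the two top trees. -/
def swap : Prog := seq toAux₁ <| seq toAux₂ <| seq (move .aux₁ .main) (move .aux₂ .main)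

theorem exec_swap (x y : SExp) (w : List Bool) :
    Exec swap (x.ser ++ (y.ser ++ w)) (y.ser ++ (x.ser ++ w))
      (10 * (x.ser.length + y.ser.length) + 6) := fun r => by
  obtain ⟨t₁, ht₁, h₁⟩ := run_toAux₁ x (y.ser ++ (w ++ r))
  obtain ⟨t₂, ht₂, h₂⟩ := run_toAux₂ y (w ++ r) x.ser.reverse
  obtain ⟨t₃, ht₃, h₃⟩ := run_move_aux₁_main (w ++ r) x.ser.reverse y.ser.reverse []
  obtain ⟨t₄, ht₄, h₄⟩ := run_move_aux₂_main (x.ser ++ (w ++ r)) [] y.ser.reverse []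
  simp only [List.reverse_reverse, List.length_reverse] at h₃ h₄ ht₃ ht₄
  refine ⟨t₁ + (t₂ + (t₃ + t₄)), by omega, ?_⟩
  simpa [swap] using h₁.seq (h₂.seq (h₃.seq h₄))

/-- Copy the top tree. -/
def dup : Prog :=
  seq toAux₁ <|
  seq (drain .aux₁ (seq (push .main true) (push .aux₂ true))
    (seq (push .main false) (push .aux₂ false))) <|
  seq (move .aux₂ .aux₁) (move .aux₁ .main)

theorem exec_dup (x : SExp) (w : List Bool) :
    Exec dup (x.ser ++ w) (x.ser ++ (x.ser ++ w)) (20 * x.ser.length + 5) := fun r => by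
  obtain ⟨t₁, ht₁, h₁⟩ := run_toAux₁ x (w ++ r)
  obtain ⟨t₂, ht₂, h₂⟩ := run_drain (k := .aux₁)
    (p := seq (push .main true) (push .aux₂ true)) (q := seq (push .main false) (push .aux₂ false))
    (S := fun u l => st (u ++ (w ++ r)) l u []) (by simp) (by simp)
    (fun _ _ => ⟨1 + 1, by simp, (run_push_main _ _ _ _ _).seq (run_push_aux₂ _ _ _ _ _)⟩)
    (fun _ _ => ⟨1 + 1, by simp, (run_push_main _ _ _ _ _).seq (run_push_aux₂ _ _ _ _ _)⟩)
    x.ser.reverse []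
  obtain ⟨t₃, ht₃, h₃⟩ := run_move_aux₂_aux₁ (x.ser ++ (w ++ r)) [] x.ser []
  obtain ⟨t₄, ht₄, h₄⟩ := run_move_aux₁_main (x.ser ++ (w ++ r)) x.ser.reverse [] []
  simp only [List.reverse_reverse, List.length_reverse, List.append_nil, List.nil_append]
    at h₂ h₃ h₄ ht₂ ht₄
  refine ⟨t₁ + (t₂ + (t₃ + t₄)), by omega, ?_⟩
  simpa [dup] using h₁.seq (h₂.seq (h₃.seq h₄))

/-- Push a word; its first bit ends up on top. -/
def pushAll : List Bool → Prog
  | [] => skip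
  | v :: l => seq (pushAll l) (push .main v)

theorem exec_pushAll (l x : List Bool) : Exec (pushAll l) x (l ++ x) (l.length + 1) := by
  induction l with
  | nil => exact exec_skip x
  | cons v l ih => exact ih.seq (exec_push v _)

end StackProgram

namespace StackProgram

open Prog Function

/-! ### Functions computed by stack programs in polynomial time -/

/-- A representation of the elements of a type by trees. -/
class Enc (α : Type) where
  /-- The tree that represents an element. -/
  enc : α → SExp

/-- The word on the stack that represents an element. -/
def word {α : Type} [Enc α] (a : α) : List Bool := (Enc.enc a).ser

/-- The length of the word that represents an element. -/
def size {α : Type} [Enc α] (a : α) : ℕ := (word a).length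

variable {α β γ σ : Type} [Enc α] [Enc β] [Enc γ] [Enc σ]

instance : Enc Unit := ⟨fun _ => .nil⟩

/-- Truth values are represented like lists of length `0` and `1` over `Unit`. -/
instance : Enc Bool := ⟨fun b => if b then .cons .nil .nil else .nil⟩

/-- Natural numbers are written in unary, like lists over `Unit`. -/
instance : Enc ℕ := ⟨fun n => Nat.rec .nil (fun _ x => .cons .nil x) n⟩

instance : Enc (α × β) := ⟨fun x => .cons (Enc.enc x.1) (Enc.enc x.2)⟩

instance : Enc (List α) := ⟨fun l => l.foldr (fun a x => .cons (Enc.enc a) x) .nil⟩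

@[simp] theorem word_true : word true = [true, false, false] := rfl
@[simp] theorem word_false : word false = [false] := rfl
theorem word_prod (a : α) (b : β) : word (a, b) = true :: (word a ++ word b) := rfl
@[simp] theorem word_nil : word ([] : List α) = [false] := rfl
theorem word_cons (a : α) (l : List α) : word (a :: l) = true :: (word a ++ word l) := rfl

@[simp] theorem size_prod (a : α) (b : β) : size (a, b) = size a + size b + 1 := by
  simp [size, word_prod]
@[simp] theorem size_nil : size ([] : List α) = 1 := rfl
@[simp] theorem size_cons (a : α) (l : List α) : size (a :: l) = size a + size l + 1 := by
  simp [size, word_cons]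

@[simp] theorem size_nat (n : ℕ) : size n = 2 * n + 1 := by
  induction n with
  | zero => rfl
  | succ n ih =>
    have : size (n + 1) = size n + 2 := by
      change (true :: ([false] ++ word n)).length = _
      simp [size]
    omega

theorem size_bool_le (b : Bool) : size b ≤ 3 := by cases b <;> simp [size]

theorem length_le_size (l : List α) : l.length ≤ size l := by
  induction l with
  | nil => simp
  | cons a l ih => simp; omega

theorem eval_mono (p : Polynomial ℕ) {m n : ℕ} (h : m ≤ n) : p.eval m ≤ p.eval n := by
  simp only [Polynomial.eval_eq_sum, Polynomial.sum]
  gcongr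

/-- Some stack program replaces the word of `a` by the word of `f a` in polynomial time. The bound
on the size of the result would follow from the bound on the time, but it is convenient to have it
as a part of the definition. -/
def PolyTime (f : α → β) : Prop :=
  ∃ (p : Prog) (P : Polynomial ℕ), ∀ a,
    Exec p (word a) (word (f a)) (P.eval (size a)) ∧ size (f a) ≤ P.eval (size a)

namespace PolyTime

theorem id : PolyTime fun a : α => a :=
  ⟨skip, .X + 1, fun a => ⟨(exec_skip _).mono (by simp), by simp⟩⟩

/-- A function that changes the type but not the representation. -/
theorem of_word_eq {f : α → β} (h : ∀ a, word (f a) = word a) : PolyTime f :=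
  ⟨skip, .X + 1, fun a => ⟨by rw [h]; exact (exec_skip _).mono (by simp), by simp [size, h]⟩⟩

theorem of_eq {f g : α → β} (hf : PolyTime f) (h : ∀ a, f a = g a) : PolyTime g := by
  rwa [show g = f from funext fun a => (h a).symm]

theorem comp {f : β → γ} {g : α → β} (hf : PolyTime f) (hg : PolyTime g) :
    PolyTime fun a => f (g a) := by
  obtain ⟨p, P, hp⟩ := hf
  obtain ⟨q, Q, hq⟩ := hg
  refine ⟨q.seq p, Q + P.comp Q, fun a => ?_⟩
  have h := eval_mono P (hq a).2
  simp only [Polynomial.eval_add, Polynomial.eval_comp]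
  exact ⟨((hq a).1.seq (hp (g a)).1).mono (by omega), (hp (g a)).2.trans (by omega)⟩

theorem const (b : β) : PolyTime fun _ : α => b := by
  refine ⟨seq drop (pushAll (word b)), 5 * .X + 3 + Polynomial.C (size b), fun a => ?_⟩
  have h1 := exec_drop (Enc.enc a) []
  have h2 := exec_pushAll (word b) []
  simp only [List.append_nil] at h1 h2
  refine ⟨(h1.seq h2).mono ?_, by simp⟩
  simp only [Polynomial.eval_add, Polynomial.eval_mul, Polynomial.eval_X, Polynomial.eval_C,
    Polynomial.eval_ofNat]
  simp only [size, word]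
  omega

theorem prod {f : α → β} {g : α → γ} (hf : PolyTime f) (hg : PolyTime g) :
    PolyTime fun a => (f a, g a) := by
  obtain ⟨p, P, hp⟩ := hf
  obtain ⟨q, Q, hq⟩ := hg
  refine ⟨seq dup (seq p (seq swap (seq q (seq swap (push .main true))))),
    40 * .X + 30 + 40 * P + 40 * Q, fun a => ?_⟩
  have h1 := exec_dup (Enc.enc a) []
  have h2 := (hp a).1.frame (Enc.enc a).ser
  have h3 := exec_swap (Enc.enc (f a)) (Enc.enc a) []
  have h4 := (hq a).1.frame (Enc.enc (f a)).ser
  have h5 := exec_swap (Enc.enc (g a)) (Enc.enc (f a)) []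
  have h6 := exec_push true (word (f a) ++ word (g a))
  have hP := (hp a).2
  have hQ := (hq a).2
  simp only [Polynomial.eval_add, Polynomial.eval_mul, Polynomial.eval_X, Polynomial.eval_ofNat,
    size_prod]
  simp only [List.append_nil] at h1 h3 h5
  refine ⟨(h1.seq (h2.seq (h3.seq (h4.seq (h5.seq h6))))).mono ?_, by omega⟩
  simp only [size, word] at *
  omega

theorem fst {f : α → β × γ} (hf : PolyTime f) : PolyTime fun a => (f a).1 := by
  refine comp (f := Prod.fst) ⟨seq pop (seq swap drop), 20 * .X + 20, fun a => ?_⟩ hf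
  have h1 := exec_pop true (word a.1 ++ word a.2)
  have h2 := exec_swap (Enc.enc a.1) (Enc.enc a.2) []
  have h3 := exec_drop (Enc.enc a.2) (word a.1)
  have hs : size a = size a.1 + size a.2 + 1 := size_prod a.1 a.2
  simp only [List.append_nil] at h2
  simp only [Polynomial.eval_add, Polynomial.eval_mul, Polynomial.eval_X, Polynomial.eval_ofNat]
  refine ⟨(h1.seq (h2.seq h3)).mono ?_, by omega⟩
  simp only [size, word] at *
  omega

theorem snd {f : α → β × γ} (hf : PolyTime f) : PolyTime fun a => (f a).2 := by
  refine comp (f := Prod.snd) ⟨seq pop drop, 20 * .X + 20, fun a => ?_⟩ hf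
  have h1 := exec_pop true (word a.1 ++ word a.2)
  have h3 := exec_drop (Enc.enc a.1) (word a.2)
  have hs : size a = size a.1 + size a.2 + 1 := size_prod a.1 a.2
  simp only [Polynomial.eval_add, Polynomial.eval_mul, Polynomial.eval_X, Polynomial.eval_ofNat]
  refine ⟨(h1.seq h3).mono ?_, by omega⟩
  simp only [size, word] at *
  omega

theorem cons {f : α → β} {g : α → List β} (hf : PolyTime f) (hg : PolyTime g) :
    PolyTime fun a => f a :: g a :=
  comp (f := fun x : β × List β => x.1 :: x.2) (of_word_eq fun _ => rfl) (prod hf hg)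

/-- Case distinction on a list. -/
theorem cases_list {f : α → List β} {g : α → γ} {h : (β × List β) × α → γ} {F : α → γ}
    (hf : PolyTime f) (hg : PolyTime g) (hh : PolyTime h) (hnil : ∀ a, f a = [] → F a = g a)
    (hcons : ∀ a b l, f a = b :: l → F a = h ((b, l), a)) : PolyTime F := by
  obtain ⟨p, P, hp⟩ := prod hf id
  obtain ⟨q, Q, hq⟩ := hg
  obtain ⟨r, R, hr⟩ := hh
  refine ⟨seq p (seq pop (popCase .main (seq (push .main true) (seq (push .main true) r)) q)),
    P + Q + R.comp P + 20, fun a => ?_⟩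
  have h1 := (hp a).1
  have h2 : size (f a, a) ≤ _ := (hp a).2
  simp only [Polynomial.eval_add, Polynomial.eval_comp, Polynomial.eval_ofNat]
  rw [word_prod] at h1
  cases hl : f a with
  | nil =>
    rw [hl] at h1
    rw [hnil a hl]
    refine ⟨(h1.seq ((exec_pop _ _).seq (hq a).1.popCase_false)).mono (by omega),
      (hq a).2.trans (by omega)⟩
  | cons b l =>
    rw [hl] at h1 h2
    rw [hcons a b l hl]
    have h3 : size ((b, l), a) ≤ P.eval (size a) := by
      simp only [size_prod, size_cons] at h2 ⊢
      omega
    have h4 := eval_mono R h3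
    have h5 : Exec r (true :: true :: (word b ++ word l ++ word a)) (word (h ((b, l), a)))
        (R.eval (P.eval (size a))) := by
      have := (hr ((b, l), a)).1.mono h4
      simpa [word_prod] using this
    refine ⟨(h1.seq ((exec_pop _ _).seq (Exec.popCase_true
      ((exec_push true _).seq ((exec_push true _).seq h5))))).mono (by omega),
      (hr _).2.trans (by omega)⟩

theorem exists_size_le {f : α → β} (hf : PolyTime f) :
    ∃ P : Polynomial ℕ, ∀ a, size (f a) ≤ P.eval (size a) :=
  let ⟨_, P, hP⟩ := hf
  ⟨P, fun a => (hP a).2⟩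

/-- Folding over a list takes polynomial time if one step does and if all intermediate results have
polynomial size. -/
theorem foldl {f : α → List β} {g : α → σ} {h : α → σ → β → σ} (hf : PolyTime f)
    (hg : PolyTime g) (hh : PolyTime fun x : (α × σ) × β => h x.1.1 x.1.2 x.2)
    (B : Polynomial ℕ)
    (hB : ∀ a l, l <+: f a → size (l.foldl (h a) (g a)) ≤ B.eval (size a)) :
    PolyTime fun a => (f a).foldl (h a) (g a) := by
  have hbody : PolyTime fun x : (β × List β) × (α × σ) =>
      (x.1.2, (x.2.1, h x.2.1 x.2.2 x.1.1)) :=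
    prod (snd (fst id)) (prod (fst (snd id)) (comp hh (prod (snd id) (fst (fst id)))))
  obtain ⟨q, Q, hq⟩ := hbody
  obtain ⟨P, hP⟩ := hf.exists_size_le
  have hloop : ∀ (a : α) (s : σ) (M : ℕ) (l : List β),
      (∀ l', l' <+: l → size (l'.foldl (h a) s) ≤ M) →
      Exec (whileTrue .main (seq (push .main true) (seq (push .main true) (seq q pop))))
        (word l ++ word (a, s)) (word (a, l.foldl (h a) s))
        (l.length * (Q.eval (size l + size a + M + 2) + 5) + 1) := by
    intro a s M l
    induction l generalizing s with
    | nil => exact fun _ => (exec_whileTrue_false _ _).mono (by simp)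
    | cons b l ih =>
      intro hM
      have h0 : size s ≤ M := hM [] List.nil_prefix
      have h1 := ih (h a s b) fun l' hl' => hM (b :: l') (by simpa using hl')
      have h2 : size ((b, l), (a, s)) ≤ size (b :: l) + size a + M + 2 := by
        simp only [size_prod, size_cons]
        omega
      have h3 := (hq ((b, l), (a, s))).1.mono (eval_mono Q h2)
      have h4 := eval_mono Q
        (show size l + size a + M + 2 ≤ size (b :: l) + size a + M + 2 by rw [size_cons]; omega)
      have h5 := Exec.whileTrue_true
        ((exec_push true (word b ++ word l ++ word (a, s))).seq
          ((exec_push true (true :: (word b ++ word l ++ word (a, s)))).seq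
            ((show Exec q (true :: true :: (word b ++ word l ++ word (a, s))) _ _ from h3).seq
              (exec_pop true (word l ++ word (a, h a s b)))))) h1
      refine Exec.mono h5 ?_
      rw [List.length_cons, Nat.succ_mul]
      have h6 := Nat.mul_le_mul_left l.length (Nat.add_le_add_right h4 5)
      omega
  refine snd (f := fun a => (a, (f a).foldl (h a) (g a))) ?_
  obtain ⟨p, R, hp⟩ := prod hf (prod id hg)
  refine ⟨seq p (seq pop
    (whileTrue .main (seq (push .main true) (seq (push .main true) (seq q pop))))),
    R + 3 + P * (Q.comp (P + .X + B + 2) + 5) + B + .X, fun a => ?_⟩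
  simp only [Polynomial.eval_add, Polynomial.eval_comp, Polynomial.eval_mul, Polynomial.eval_X,
    Polynomial.eval_ofNat]
  constructor
  · have h1 := (hp a).1
    rw [word_prod] at h1
    refine (h1.seq ((exec_pop _ _).seq (hloop a (g a) (B.eval (size a)) (f a) (hB a)))).mono ?_
    have h2 : (f a).length ≤ P.eval (size a) := (length_le_size _).trans (hP a)
    have h3 := eval_mono Q (show size (f a) + size a + B.eval (size a) + 2 ≤
      P.eval (size a) + size a + B.eval (size a) + 2 by have := hP a; omega)
    have h4 := Nat.mul_le_mul h2 (Nat.add_le_add_right h3 5)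
    omega
  · have := hB a (f a) List.prefix_rfl
    rw [size_prod]
    omega

/-- Folding over a list takes polynomial time if one step does and if it increases the size of the
accumulator by an amount that does not depend on the accumulator. -/
theorem foldl_of_add {f : α → List β} {g : α → σ} {h : α → σ → β → σ} (hf : PolyTime f)
    (hg : PolyTime g) (hh : PolyTime fun x : (α × σ) × β => h x.1.1 x.1.2 x.2)
    (B : Polynomial ℕ)
    (hB : ∀ a s b, size (h a s b) ≤ size s + B.eval (size a + size b)) :
    PolyTime fun a => (f a).foldl (h a) (g a) := by
  obtain ⟨P, hP⟩ := hf.exists_size_le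
  obtain ⟨R, hR⟩ := hg.exists_size_le
  refine foldl hf hg hh (R + P * B.comp (.X + P)) fun a l hl => ?_
  have key : ∀ (l : List β) (s : σ) (n : ℕ), size l ≤ n →
      size (l.foldl (h a) s) ≤ size s + l.length * B.eval (size a + n) := by
    intro l
    induction l with
    | nil => intro s n _; simp
    | cons b l ih =>
      intro s n hn
      rw [size_cons] at hn
      have h1 := ih (h a s b) n (by omega)
      have h2 := hB a s b
      have h3 := eval_mono B (show size a + size b ≤ size a + n by omega)
      rw [List.length_cons, Nat.succ_mul, List.foldl_cons]
      omega
  have hsz : size l ≤ size (f a) := by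
    obtain ⟨m, hm⟩ := hl
    rw [← hm]
    clear hm
    induction l with
    | nil => cases m <;> simp [size_cons]
    | cons b l ih => simpa using ih
  have h1 := key l (g a) (P.eval (size a)) (hsz.trans (hP a))
  have h2 := Nat.mul_le_mul_right (B.eval (size a + P.eval (size a)))
    ((length_le_size l).trans (hsz.trans (hP a)))
  have h3 := hR a
  simp only [Polynomial.eval_add, Polynomial.eval_comp, Polynomial.eval_mul, Polynomial.eval_X]
  omega

end PolyTime

end StackProgram

namespace StackProgram

/-! ### Polynomial time operations on lists and numbers -/

variable {α β γ σ : Type} [Enc α] [Enc β] [Enc γ] [Enc σ]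

theorem size_append (l l' : List α) : size (l ++ l') + 1 = size l + size l' := by
  induction l with
  | nil => simp; omega
  | cons a l ih => simp; omega

theorem size_le_of_forall_mem {l : List α} {m : ℕ} (h : ∀ a ∈ l, size a ≤ m) :
    size l ≤ l.length * (m + 1) + 1 := by
  induction l with
  | nil => simp
  | cons a l ih =>
    have h1 := ih fun b hb => h b (List.mem_cons_of_mem _ hb)
    have h2 := h a List.mem_cons_self
    rw [size_cons, List.length_cons, Nat.succ_mul]
    omega

theorem size_tail_le (l : List α) : size l.tail ≤ size l := by
  cases l <;> simp
  omega

theorem word_replicate (n : ℕ) : word (List.replicate n ()) = word n := by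
  induction n with
  | zero => rfl
  | succ n ih =>
    rw [List.replicate_succ, word_cons, ih]
    rfl

namespace PolyTime

theorem comp₂ {f : β → γ → σ} {g : α → β} {h : α → γ}
    (hf : PolyTime fun x : β × γ => f x.1 x.2) (hg : PolyTime g) (hh : PolyTime h) :
    PolyTime fun a => f (g a) (h a) :=
  comp hf (prod hg hh)

theorem cond {c : α → Bool} {f g : α → β} (hc : PolyTime c) (hf : PolyTime f) (hg : PolyTime g) :
    PolyTime fun a => bif c a then f a else g a := by
  have hc' : PolyTime fun a => bif c a then [()] else [] :=
    comp (f := fun b : Bool => bif b then [()] else [])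
      (of_word_eq fun b => by cases b <;> rfl) hc
  refine cases_list hc' hg (h := fun x => f x.2) (comp hf (snd id)) (fun a ha => ?_)
    (fun a b l ha => ?_)
  · cases h : c a <;> simp [h] at ha ⊢
  · cases h : c a <;> simp [h] at ha ⊢

theorem not {c : α → Bool} (hc : PolyTime c) : PolyTime fun a => !c a :=
  (cond hc (const false) (const true)).of_eq fun a => by cases c a <;> rfl

theorem and {c d : α → Bool} (hc : PolyTime c) (hd : PolyTime d) : PolyTime fun a => c a && d a :=
  (cond hc hd (const false)).of_eq fun a => by cases c a <;> rfl

theorem or {c d : α → Bool} (hc : PolyTime c) (hd : PolyTime d) : PolyTime fun a => c a || d a :=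
  (cond hc (const true) hd).of_eq fun a => by cases c a <;> rfl

theorem beq_bool {c d : α → Bool} (hc : PolyTime c) (hd : PolyTime d) :
    PolyTime fun a => c a == d a :=
  (cond hc hd (not hd)).of_eq fun a => by cases c a <;> cases d a <;> rfl

theorem isEmpty {f : α → List β} (hf : PolyTime f) : PolyTime fun a => (f a).isEmpty :=
  cases_list (h := fun _ => false) hf (const true) (const false) (fun a h => by simp [h])
    (fun a b l h => by simp [h])

theorem tail {f : α → List β} (hf : PolyTime f) : PolyTime fun a => (f a).tail :=
  cases_list (h := fun x => x.1.2) hf (const []) (snd (fst id)) (fun a h => by simp [h])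
    (fun a b l h => by simp [h])

theorem headD {f : α → List β} {g : α → β} (hf : PolyTime f) (hg : PolyTime g) :
    PolyTime fun a => (f a).headD (g a) :=
  cases_list (h := fun x => x.1.1) hf hg (fst (fst id)) (fun a h => by simp [h])
    (fun a b l h => by simp [h])

theorem reverse {f : α → List β} (hf : PolyTime f) : PolyTime fun a => (f a).reverse := by
  refine (foldl_of_add (h := fun _ s b => b :: s) hf (const []) (cons (snd id) (snd (fst id)))
    (.X + 1) fun a s b => ?_).of_eq fun a => by simp
  simp only [size_cons, Polynomial.eval_add, Polynomial.eval_X, Polynomial.eval_one]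
  omega

theorem append {f g : α → List β} (hf : PolyTime f) (hg : PolyTime g) :
    PolyTime fun a => f a ++ g a := by
  refine (foldl_of_add (h := fun _ s b => b :: s) (reverse hf) hg (cons (snd id) (snd (fst id)))
    (.X + 1) fun a s b => ?_).of_eq fun a => by simp
  simp only [size_cons, Polynomial.eval_add, Polynomial.eval_X, Polynomial.eval_one]
  omega

theorem flatMap {f : α → List β} {g : α → β → List γ} (hf : PolyTime f)
    (hg : PolyTime fun x : α × β => g x.1 x.2) : PolyTime fun a => (f a).flatMap (g a) := by
  obtain ⟨P, hP⟩ := hg.exists_size_le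
  refine (foldl_of_add (h := fun a s b => s ++ g a b) hf (const [])
    (append (snd (fst id)) (comp₂ hg (fst (fst id)) (snd id))) (P.comp (.X + 1))
    fun a s b => ?_).of_eq fun a => ?_
  · have h1 := hP (a, b)
    have h2 := size_append s (g a b)
    simp only [size_prod, Polynomial.eval_comp, Polynomial.eval_add, Polynomial.eval_X,
      Polynomial.eval_one] at h1 ⊢
    omega
  · have key : ∀ (l : List β) (s : List γ),
        l.foldl (fun s b => s ++ g a b) s = s ++ l.flatMap (g a) := by
      intro l
      induction l with
      | nil => simp
      | cons b l ih => intro s; rw [List.foldl_cons, ih, List.flatMap_cons, List.append_assoc]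
    exact key _ _

theorem map {f : α → List β} {g : α → β → γ} (hf : PolyTime f)
    (hg : PolyTime fun x : α × β => g x.1 x.2) : PolyTime fun a => (f a).map (g a) :=
  (flatMap hf (cons hg (const []))).of_eq fun _ => List.map_eq_flatMap.symm

theorem filter {f : α → List β} {p : α → β → Bool} (hf : PolyTime f)
    (hp : PolyTime fun x : α × β => p x.1 x.2) : PolyTime fun a => (f a).filter (p a) := by
  refine (flatMap (g := fun a b => bif p a b then [b] else []) hf
    (cond hp (cons (snd id) (const [])) (const []))).of_eq fun a => ?_
  induction f a with
  | nil => rfl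
  | cons b l ih => cases h : p a b <;> simp [ih, h]

theorem any {f : α → List β} {p : α → β → Bool} (hf : PolyTime f)
    (hp : PolyTime fun x : α × β => p x.1 x.2) : PolyTime fun a => (f a).any (p a) := by
  refine (not (isEmpty (filter hf hp))).of_eq fun a => ?_
  rw [Bool.eq_iff_iff]
  simp

theorem all {f : α → List β} {p : α → β → Bool} (hf : PolyTime f)
    (hp : PolyTime fun x : α × β => p x.1 x.2) : PolyTime fun a => (f a).all (p a) := by
  refine (isEmpty (filter (p := fun a b => !p a b) hf (not hp))).of_eq fun a => ?_
  rw [Bool.eq_iff_iff]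
  simp

theorem replicate {f : α → ℕ} (hf : PolyTime f) : PolyTime fun a => List.replicate (f a) () :=
  comp (of_word_eq word_replicate) hf

theorem length_unit {f : α → List Unit} (hf : PolyTime f) : PolyTime fun a => (f a).length :=
  comp (f := List.length) (of_word_eq fun l => by
    rw [← word_replicate, ← List.eq_replicate_length.2 fun _ _ => rfl]) hf

theorem length {f : α → List β} (hf : PolyTime f) : PolyTime fun a => (f a).length :=
  (length_unit (map (g := fun _ _ => ()) hf (const ()))).of_eq fun a => by simp

theorem add {f g : α → ℕ} (hf : PolyTime f) (hg : PolyTime g) : PolyTime fun a => f a + g a :=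
  (length (append (replicate hf) (replicate hg))).of_eq fun a => by simp

theorem mul {f g : α → ℕ} (hf : PolyTime f) (hg : PolyTime g) : PolyTime fun a => f a * g a :=
  (length (flatMap (g := fun a _ => List.replicate (g a) ()) (replicate hf)
    (comp (replicate hg) (fst id)))).of_eq fun a => by simp

theorem drop {f : α → ℕ} {g : α → List β} (hf : PolyTime f) (hg : PolyTime g) :
    PolyTime fun a => (g a).drop (f a) := by
  refine (foldl_of_add (h := fun _ s _ => s.tail) (replicate hf) hg (tail (snd (fst id))) 0
    fun a s b => by simpa using size_tail_le s).of_eq fun a => ?_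
  have key : ∀ (n : ℕ) (l : List β),
      (List.replicate n ()).foldl (fun s _ => s.tail) l = l.drop n := by
    intro n
    induction n with
    | zero => simp
    | succ n ih => intro l; rw [List.replicate_succ, List.foldl_cons, ih, List.drop_tail]
  exact key _ _

theorem sub {f g : α → ℕ} (hf : PolyTime f) (hg : PolyTime g) : PolyTime fun a => f a - g a :=
  (length (drop hg (replicate hf))).of_eq fun a => by simp

theorem ble {f g : α → ℕ} (hf : PolyTime f) (hg : PolyTime g) :
    PolyTime fun a => (f a).ble (g a) :=
  (isEmpty (replicate (sub hf hg))).of_eq fun a => by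
    rw [Bool.eq_iff_iff]
    simp [Nat.sub_eq_zero_iff_le]

theorem beq {f g : α → ℕ} (hf : PolyTime f) (hg : PolyTime g) : PolyTime fun a => f a == g a :=
  (and (ble hf hg) (ble hg hf)).of_eq fun a => by
    rw [Bool.eq_iff_iff]
    simp only [Bool.and_eq_true, Nat.ble_eq, beq_iff_eq]
    omega

theorem contains {f : α → List ℕ} {g : α → ℕ} (hf : PolyTime f) (hg : PolyTime g) :
    PolyTime fun a => (f a).contains (g a) :=
  (any (p := fun a b => g a == b) hf (beq (comp hg (fst id)) (snd id))).of_eq fun a => by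
    rw [List.contains_eq_any_beq]

theorem range {f : α → ℕ} (hf : PolyTime f) : PolyTime fun a => List.range (f a) := by
  have key : ∀ l : List Unit, l.foldl (fun s _ => s.length :: s) [] =
      (List.range l.length).reverse := by
    intro l
    induction l using List.reverseRecOn with
    | nil => rfl
    | append_singleton l b ih => simp [ih, List.range_succ]
  obtain ⟨P, hP⟩ := hf.exists_size_le
  refine (reverse (foldl (h := fun _ s _ => s.length :: s) (replicate hf) (const [])
    (cons (length (snd (fst id))) (snd (fst id))) (P * (2 * P + 2) + 1)
    fun a l hl => ?_)).of_eq fun a => by rw [key]; simp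
  have h1 := hP a
  have h2 := hl.length_le
  rw [key]
  rw [List.length_replicate] at h2
  rw [size_nat] at h1
  refine (size_le_of_forall_mem (m := 2 * P.eval (size a) + 1) fun k hk => ?_).trans ?_
  · simp only [List.mem_reverse, List.mem_range] at hk
    rw [size_nat]
    omega
  · simp only [List.length_reverse, List.length_range, Polynomial.eval_add, Polynomial.eval_mul,
      Polynomial.eval_ofNat, Polynomial.eval_one]
    refine Nat.succ_le_succ (Nat.mul_le_mul ?_ ?_) <;> omega

end PolyTime

end StackProgram

namespace VertexDeletion

/-! ### Simplicial vertices of chordal graphs -/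

open SimpleGraph

/-- A shortest walk has no chords. -/
theorem mem_edges_of_length_eq_dist {V : Type} {G : SimpleGraph V} {x y a b : V} {p : G.Walk x y}
    (hp : p.length = G.dist x y) (ha : a ∈ p.support) (hb : b ∈ p.support) (hab : G.Adj a b) :
    s(a, b) ∈ p.edges := by
  obtain ⟨i, rfl, hi⟩ := Walk.mem_support_iff_exists_getVert.1 ha
  obtain ⟨j, rfl, hj⟩ := Walk.mem_support_iff_exists_getVert.1 hb
  have key : ∀ i j, j ≤ p.length → i < j → G.Adj (p.getVert i) (p.getVert j) →
      s(p.getVert i, p.getVert j) ∈ p.edges := by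
    intro i j hj hij h
    have h1 := dist_le ((p.take i).append (Walk.cons h (p.drop j)))
    simp only [Walk.length_append, Walk.length_cons, Walk.take_length, Walk.drop_length] at h1
    obtain rfl : j = i + 1 := by omega
    exact (Walk.mk_mem_edges_iff_exists p).2 ⟨i, by omega, rfl⟩
  rcases lt_trichotomy i j with h | rfl | h
  · exact key i j hj h hab
  · exact (hab.ne rfl).elim
  · rw [Sym2.eq_swap]
    exact key j i hi h hab.symm

/-- In a chordal graph, two neighbours of a vertex `v` that are joined by a path whose inner
vertices are neither equal nor adjacent to `v` are adjacent. -/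
theorem Chordal.adj_of_reachable {V : Type} {G : SimpleGraph V} (hG : Chordal G) {v x y : V}
    {D : Set V} (hD : ∀ w ∈ D, w ≠ v ∧ ¬ G.Adj v w) (hvx : G.Adj v x) (hvy : G.Adj v y)
    (hxy : x ≠ y)
    (hr : (G.induce (D ∪ {x, y})).Reachable ⟨x, by simp⟩ ⟨y, by simp⟩) : G.Adj x y := by
  by_contra hadj
  obtain ⟨p, hp, hlen⟩ := hr.exists_path_of_dist
  have hmem : ∀ w ∈ D ∪ {x, y}, w ≠ v := by
    rintro w (hw | rfl | rfl)
    · exact (hD w hw).1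
    · exact hvx.ne'
    · exact hvy.ne'
  have hnbr : ∀ w ∈ D ∪ {x, y}, G.Adj v w → w = x ∨ w = y := by
    rintro w (hw | hw) h
    · exact ((hD w hw).2 h).elim
    · exact hw
  have hlen2 : 2 ≤ p.length := by
    by_contra! h
    interval_cases hl : p.length
    · exact hxy (congrArg Subtype.val (Walk.eq_of_length_eq_zero hl))
    · exact hadj (by simpa using Walk.adj_of_length_eq_one hl)
  obtain ⟨p', hp', hps, hpe, hpl⟩ : ∃ p' : G.Walk x y, p'.IsPath ∧
      p'.support = p.support.map Subtype.val ∧ p'.edges = p.edges.map (Sym2.map Subtype.val) ∧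
      p'.length = p.length :=
    ⟨p.map (Embedding.induce _).toHom, hp.map Subtype.val_injective, Walk.support_map _ _,
      Walk.edges_map _ _, Walk.length_map _ _⟩
  have hsupp : ∀ w ∈ p'.support, ∃ w' ∈ p.support, w'.1 = w := by
    intro w hw
    rwa [hps, List.mem_map] at hw
  have hv : v ∉ p'.support := by
    intro h
    obtain ⟨w, -, rfl⟩ := hsupp v h
    exact hmem _ w.2 rfl
  let c : G.Walk v v := Walk.cons hvx (p'.concat hvy.symm)
  have hc : c.IsCycle := by
    rw [Walk.cons_isCycle_iff]
    refine ⟨hp'.concat hv hvy.symm, ?_⟩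
    rw [Walk.edges_concat, List.concat_eq_append, List.mem_append, not_or]
    refine ⟨fun h => hv (p'.fst_mem_support_of_mem_edges h), ?_⟩
    simp only [List.mem_singleton, Sym2.eq_iff]
    rintro (⟨h, -⟩ | ⟨-, h⟩)
    · exact hvy.ne h
    · exact hxy h
  have hce : ∀ e, e ∈ c.edges ↔ e = s(v, x) ∨ e ∈ p'.edges ∨ e = s(y, v) := by
    intro e
    simp [c, Walk.edges_concat]
  have hcs : ∀ w ∈ c.support, w = v ∨ w ∈ p'.support := by
    intro w hw
    simp only [c, Walk.support_cons, Walk.support_concat, List.mem_cons,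
      List.mem_append, List.not_mem_nil, or_false] at hw
    tauto
  have hvw : ∀ w ∈ p'.support, G.Adj v w → s(v, w) ∈ c.edges := by
    intro w hw h
    obtain ⟨w', -, rfl⟩ := hsupp w hw
    rw [hce]
    rcases hnbr _ w'.2 h with h | h
    · exact Or.inl (by rw [h])
    · exact Or.inr (Or.inr (by rw [h, Sym2.eq_swap]))
  obtain ⟨a, ha, b, hb, hab, he⟩ := hG v c hc (by
    simp only [c, Walk.length_cons, Walk.length_concat]; omega)
  rcases hcs a ha with rfl | ha'
  · rcases hcs b hb with rfl | hb'
    · exact hab.ne rfl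
    · exact he (hvw b hb' hab)
  · rcases hcs b hb with rfl | hb'
    · exact he (Sym2.eq_swap ▸ hvw a ha' hab.symm)
    · obtain ⟨a', ha₁, rfl⟩ := hsupp a ha'
      obtain ⟨b', hb₁, rfl⟩ := hsupp b hb'
      refine he ((hce _).2 (Or.inr (Or.inl ?_)))
      have := mem_edges_of_length_eq_dist hlen ha₁ hb₁ hab
      rw [hpe, List.mem_map]
      exact ⟨_, this, rfl⟩

/-- The neighbours of `c` in `A` are pairwise adjacent. -/
def SimplicialIn {V : Type} (G : SimpleGraph V) (A : Finset V) (c : V) : Prop :=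
  ∀ x ∈ A, ∀ y ∈ A, G.Adj c x → G.Adj c y → x ≠ y → G.Adj x y

open Classical in
/-- A vertex of a chordal graph that is not adjacent to all others has a simplicial vertex among
its non-neighbours. -/
theorem Chordal.exists_simplicial_not_adj {V : Type} {G : SimpleGraph V} (hG : Chordal G)
    (A : Finset V) : ∀ v ∈ A, ∀ u ∈ A, u ≠ v → ¬ G.Adj v u →
      ∃ c ∈ A, c ≠ v ∧ ¬ G.Adj v c ∧ SimplicialIn G A c := by
  induction A using Finset.strongInduction with
  | H A ih =>
  intro v hv u hu huv hvu
  -- `C` is the component of `u` in the graph without `v` and its neighbours, `S` its neighbourhood.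
  let D : Set V := {w | w ∈ A ∧ w ≠ v ∧ ¬ G.Adj v w}
  have huD : u ∈ D := ⟨hu, huv, hvu⟩
  let C : Finset V := A.filter fun w =>
    ∃ h : w ∈ D, (G.induce D).Reachable ⟨u, huD⟩ ⟨w, h⟩
  let S : Finset V := A.filter fun s => G.Adj v s ∧ ∃ w ∈ C, G.Adj w s
  have hCA : C ⊆ A := Finset.filter_subset _ _
  have hSA : S ⊆ A := Finset.filter_subset _ _
  have hCD : ∀ w ∈ C, w ∈ D := fun w hw => (Finset.mem_filter.1 hw).2.1
  have huC : u ∈ C := Finset.mem_filter.2 ⟨hu, huD, Reachable.refl _⟩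
  have hvC : v ∉ C := fun h => (hCD v h).2.1 rfl
  have hvS : v ∉ S := fun h => (Finset.mem_filter.1 h).2.1.ne rfl
  have hnbr : ∀ c ∈ C, ∀ z ∈ A, G.Adj c z → z ∈ C ∨ z ∈ S := by
    intro c hc z hz hcz
    by_cases hvz : G.Adj v z
    · exact Or.inr (Finset.mem_filter.2 ⟨hz, hvz, c, hc, hcz⟩)
    · left
      obtain ⟨-, hcD, hr⟩ := Finset.mem_filter.1 hc
      have hzD : z ∈ D := ⟨hz, fun h => hcD.2.2 (h ▸ hcz.symm), hvz⟩
      refine Finset.mem_filter.2 ⟨hz, hzD, hr.trans (Adj.reachable ?_)⟩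
      exact hcz
  have hS : ∀ x ∈ S, ∀ y ∈ S, x ≠ y → G.Adj x y := by
    intro x hx y hy hxy
    obtain ⟨-, hvx, w, hw, hwx⟩ := Finset.mem_filter.1 hx
    obtain ⟨-, hvy, w', hw', hwy⟩ := Finset.mem_filter.1 hy
    obtain ⟨-, hwD, hr⟩ := Finset.mem_filter.1 hw
    obtain ⟨-, hwD', hr'⟩ := Finset.mem_filter.1 hw'
    refine hG.adj_of_reachable (D := D) (fun w hw => hw.2) hvx hvy hxy ?_
    have hle : D ⊆ D ∪ {x, y} := Set.subset_union_left
    have h := (hr.symm.trans hr').map (induceHomOfLE G hle).toHom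
    refine Reachable.trans (Adj.reachable ?_) (h.trans (Adj.reachable ?_))
    · exact hwx.symm
    · exact hwy
  have hlt : ∀ B, B ⊆ A → v ∉ B → B ⊂ A := fun B hB hvB =>
    (Finset.ssubset_iff_of_subset hB).2 ⟨v, hv, hvB⟩
  suffices h : ∃ c ∈ C, SimplicialIn G (C ∪ S) c by
    obtain ⟨c, hc, hs⟩ := h
    refine ⟨c, hCA hc, (hCD c hc).2.1, (hCD c hc).2.2, fun x hx y hy hcx hcy => ?_⟩
    exact hs x (Finset.mem_union.2 (hnbr c hc x hx hcx)) y (Finset.mem_union.2 (hnbr c hc y hy hcy))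
      hcx hcy
  by_cases h : ∃ s ∈ S, ∃ t ∈ C ∪ S, t ≠ s ∧ ¬ G.Adj s t
  · obtain ⟨s, hs, t, ht, hts, hst⟩ := h
    obtain ⟨c, hc, hcs, hsc, hsimp⟩ := ih (C ∪ S)
      (hlt _ (Finset.union_subset hCA hSA) (by simp [hvC, hvS])) s
      (Finset.mem_union_right _ hs) t ht hts hst
    rcases Finset.mem_union.1 hc with hc | hc
    · exact ⟨c, hc, hsimp⟩
    · exact (hsc (hS s hs c hc hcs.symm)).elim
  · push Not at h
    obtain ⟨c, hc, hsimp⟩ : ∃ c ∈ C, SimplicialIn G C c := by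
      by_cases h' : ∃ s ∈ C, ∃ t ∈ C, t ≠ s ∧ ¬ G.Adj s t
      · obtain ⟨s, hs, t, ht, hts, hst⟩ := h'
        obtain ⟨c, hc, -, -, hsimp⟩ := ih C (hlt _ hCA hvC) s hs t ht hts hst
        exact ⟨c, hc, hsimp⟩
      · push Not at h'
        exact ⟨u, huC, fun x hx y hy _ _ hxy => h' x hx y hy hxy.symm⟩
    refine ⟨c, hc, fun x hx y hy hcx hcy hxy => ?_⟩
    rcases Finset.mem_union.1 hx with hx' | hx'
    · rcases Finset.mem_union.1 hy with hy' | hy'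
      · exact hsimp x hx' y hy' hcx hcy hxy
      · exact (h y hy' x hx hxy).symm
    · exact h x hx' y hy hxy.symm

theorem Chordal.exists_simplicial {V : Type} {G : SimpleGraph V} (hG : Chordal G) {A : Finset V}
    (hA : A.Nonempty) : ∃ c ∈ A, SimplicialIn G A c := by
  by_cases h : ∃ v ∈ A, ∃ u ∈ A, u ≠ v ∧ ¬ G.Adj v u
  · obtain ⟨v, hv, u, hu, huv, hvu⟩ := h
    obtain ⟨c, hc, -, -, hs⟩ := hG.exists_simplicial_not_adj A v hv u hu huv hvu
    exact ⟨c, hc, hs⟩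
  · push Not at h
    obtain ⟨c, hc⟩ := hA
    exact ⟨c, hc, fun x hx y hy _ _ hxy => h x hx y hy hxy.symm⟩

end VertexDeletion

namespace VertexDeletion

/-! ### The elimination algorithm -/

/-- The partial solutions that belong to an eliminated vertex: the scope, which is the set of later
neighbours of the vertex, and a table of pairs `(S, W)`, where `W` is the best choice among the
vertices on which the eliminated vertex decides when `S` is the part of the scope that is kept. -/
abbrev Factor : Type := List ℕ × List (List ℕ × List ℕ)

/-- The vertices that are left, and the factors of which the scopes contain only such vertices. -/
abbrev ElimState : Type := List ℕ × List Factor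

/-- Whether two sets have the same intersection with the scope. -/
def agree (scope S X : List ℕ) : Bool := scope.all fun s => S.contains s == X.contains s

/-- The table entry for the set `X` of kept vertices; it depends only on `X ∩ φ.1`. -/
def lookup (φ : Factor) (X : List ℕ) : List ℕ :=
  ((φ.2.filter fun e => agree φ.1 e.1 X).headD ([], [])).2

/-- The union of the table entries for `X` over a list of factors. -/
def lookupAll (F : List Factor) (X : List ℕ) : List ℕ := F.flatMap fun φ => lookup φ X

/-- All lists of at most `k` elements of `l`. -/
def tuples : ℕ → List ℕ → List (List ℕ)
  | 0, _ => [[]]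
  | k + 1, l => (tuples k l).flatMap fun S => S :: l.map fun x => x :: S

/-- The better one of the two solutions that delete and keep `v` respectively, when `S` is the part
of the scope that is kept. -/
def best (q v : ℕ) (scope : List ℕ) (J : List Factor) (S : List ℕ) : List ℕ :=
  bif ((scope.filter fun x => S.contains x).length + 1).ble q &&
      (lookupAll J S).length.ble (v :: lookupAll J (v :: S)).length
  then v :: lookupAll J (v :: S) else lookupAll J S

/-- Whether the neighbours of `v` in `R` are pairwise adjacent. -/
def isSimplicial (adj : ℕ → ℕ → Bool) (R : List ℕ) (v : ℕ) : Bool :=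
  R.all fun x => R.all fun y => !(adj v x && adj v y && !(x == y)) || adj x y

/-- The neighbours of `v` in `R`. -/
def scopeOf (adj : ℕ → ℕ → Bool) (R : List ℕ) (v : ℕ) : List ℕ :=
  R.filter fun x => adj v x && !(x == v)

/-- The factor that is created by the elimination of `v`. -/
def newFactor (adj : ℕ → ℕ → Bool) (q : ℕ) (s : ElimState) (v : ℕ) : Factor :=
  (scopeOf adj s.1 v, (tuples q (scopeOf adj s.1 v)).map fun S =>
    (S, best q v (scopeOf adj s.1 v) (s.2.filter fun φ => φ.1.contains v) S))

/-- Eliminate the vertex `v`. -/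
def eliminate (adj : ℕ → ℕ → Bool) (q : ℕ) (s : ElimState) (v : ℕ) : ElimState :=
  (s.1.filter fun x => !(x == v),
    newFactor adj q s v :: s.2.filter fun φ => !φ.1.contains v)

/-- Eliminate a simplicial vertex, if there is one. -/
def elimStep (adj : ℕ → ℕ → Bool) (q : ℕ) (s : ElimState) : ElimState :=
  match s.1.filter (isSimplicial adj s.1) with
  | [] => s
  | v :: _ => eliminate adj q s v

/-- The state after the elimination of all of the vertices `0, …, n - 1`. -/
def elimAll (adj : ℕ → ℕ → Bool) (q n : ℕ) : ElimState :=
  (List.range n).foldl (fun s _ => elimStep adj q s) (List.range n, [])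

/-- A largest set of vertices without a clique on `q + 1` vertices. -/
def solve (adj : ℕ → ℕ → Bool) (q n : ℕ) : List ℕ := lookupAll (elimAll adj q n).2 []

/-! ### Correctness of the elimination algorithm -/

theorem agree_iff {scope S X : List ℕ} :
    agree scope S X = true ↔ ∀ s ∈ scope, (s ∈ S ↔ s ∈ X) := by
  simp only [agree, List.all_eq_true, beq_iff_eq]
  refine forall₂_congr fun x _ => ?_
  rw [Bool.eq_iff_iff]
  simp

theorem lookup_congr {φ : Factor} {X Y : List ℕ} (h : ∀ s ∈ φ.1, (s ∈ X ↔ s ∈ Y)) :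
    lookup φ X = lookup φ Y := by
  have : ∀ S, agree φ.1 S X = agree φ.1 S Y := fun S => by
    rw [Bool.eq_iff_iff, agree_iff, agree_iff]
    exact forall₂_congr fun s hs => by rw [h s hs]
  simp only [lookup, this]

theorem lookupAll_congr {F : List Factor} {X Y : List ℕ}
    (h : ∀ φ ∈ F, ∀ s ∈ φ.1, (s ∈ X ↔ s ∈ Y)) : lookupAll F X = lookupAll F Y :=
  List.flatMap_congr fun φ hφ => lookup_congr (h φ hφ)

theorem mem_tuples {l : List ℕ} {k : ℕ} {S : List ℕ} (hS : S.length ≤ k) (h : ∀ x ∈ S, x ∈ l) :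
    S ∈ tuples k l := by
  induction k generalizing S with
  | zero => simp_all [tuples]
  | succ k ih =>
    rw [tuples, List.mem_flatMap]
    rcases S with _ | ⟨x, S⟩
    · exact ⟨[], ih (by simp) (by simp), List.mem_cons_self⟩
    · exact ⟨S, ih (by simpa using hS) fun y hy => h y (List.mem_cons_of_mem _ hy),
        List.mem_cons_of_mem _ (List.mem_map.2 ⟨x, h x List.mem_cons_self, rfl⟩)⟩

theorem mem_of_mem_tuples {l : List ℕ} {k : ℕ} {S : List ℕ} (hS : S ∈ tuples k l) :
    S.length ≤ k ∧ ∀ x ∈ S, x ∈ l := by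
  induction k generalizing S with
  | zero => simp_all [tuples]
  | succ k ih =>
    rw [tuples, List.mem_flatMap] at hS
    obtain ⟨T, hT, hS⟩ := hS
    obtain ⟨h1, h2⟩ := ih hT
    rw [List.mem_cons, List.mem_map] at hS
    rcases hS with rfl | ⟨x, hx, rfl⟩
    · exact ⟨by omega, h2⟩
    · refine ⟨by simpa using h1, fun y hy => ?_⟩
      rcases List.mem_cons.1 hy with rfl | hy
      · exact hx
      · exact h2 y hy

/-- The cliques of `H` inside `X` have at most `q` vertices. -/
def CliquesLE (H : SimpleGraph ℕ) (q : ℕ) (X : Set ℕ) : Prop :=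
  ∀ t : Finset ℕ, ↑t ⊆ X → H.IsClique (t : Set ℕ) → t.card ≤ q

theorem CliquesLE.mono {H : SimpleGraph ℕ} {q : ℕ} {X Y : Set ℕ} (h : CliquesLE H q X)
    (hYX : Y ⊆ X) : CliquesLE H q Y := fun t ht => h t (ht.trans hYX)

/-- `Y` is a best extension of `X` by vertices of `U` that are no longer left. -/
structure IsBestExtension (H : SimpleGraph ℕ) (q : ℕ) (U : Finset ℕ) (R X Y : List ℕ) : Prop where
  nodup : Y.Nodup
  mem : ∀ w ∈ Y, w ∈ U ∧ w ∉ R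
  cliquesLE : CliquesLE H q {x | x ∈ X ∨ x ∈ Y}
  le : ∀ W : Finset ℕ, W ⊆ U → CliquesLE H q W → (∀ x ∈ R, (x ∈ W ↔ x ∈ X)) →
    (W.filter (· ∉ R)).card ≤ Y.length

/-- The invariant of the algorithm: the factors give a best extension of every set of vertices that
are left. -/
structure Invariant (H : SimpleGraph ℕ) (q : ℕ) (U : Finset ℕ) (s : ElimState) : Prop where
  nodup : s.1.Nodup
  sub : ∀ x ∈ s.1, x ∈ U
  scope_sub : ∀ φ ∈ s.2, ∀ x ∈ φ.1, x ∈ s.1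
  scope_clique : ∀ φ ∈ s.2, H.IsClique {x | x ∈ φ.1}
  extension : ∀ X : List ℕ, (∀ x ∈ X, x ∈ s.1) → CliquesLE H q {x | x ∈ X} →
    IsBestExtension H q U s.1 X (lookupAll s.2 X)

variable {H : SimpleGraph ℕ} {q : ℕ} {U : Finset ℕ} {s : ElimState} {adj : ℕ → ℕ → Bool}

theorem mem_scopeOf (hadj : ∀ i j, adj i j = true ↔ H.Adj i j) {R : List ℕ} {v x : ℕ} :
    x ∈ scopeOf adj R v ↔ x ∈ R ∧ H.Adj v x := by
  simp only [scopeOf, List.mem_filter, Bool.and_eq_true, hadj, Bool.not_eq_true',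
    beq_eq_false_iff_ne]
  exact ⟨fun h => ⟨h.1, h.2.1⟩, fun h => ⟨h.1, h.2, h.2.ne'⟩⟩

/-- The number of kept vertices in a clique is at most `q`. -/
theorem length_filter_le {l X : List ℕ} (hl : l.Nodup) (hc : H.IsClique {x | x ∈ l})
    (hX : CliquesLE H q {x | x ∈ X}) : (l.filter fun x => X.contains x).length ≤ q := by
  rw [← List.toFinset_card_of_nodup (hl.filter _)]
  refine hX _ (fun x hx => ?_) (hc.subset fun x hx => ?_)
  · simp at hx
    exact hx.2
  · simp at hx
    exact hx.1

/-- The new table has the correct entry for every set without large cliques, although it lists only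
the subsets of the scope with at most `q` elements: the scope is a clique, and the entry for a set
depends only on the intersection of the set with the scope. -/
theorem lookup_newFactor (hadj : ∀ i j, adj i j = true ↔ H.Adj i j) (hs : Invariant H q U s)
    {v : ℕ} (hsimp : H.IsClique {x | x ∈ scopeOf adj s.1 v}) {X : List ℕ}
    (hX : ∀ x ∈ X, x ∈ s.1 ∧ x ≠ v) (hXq : CliquesLE H q {x | x ∈ X}) :
    lookup (newFactor adj q s v) X =
      best q v (scopeOf adj s.1 v) (s.2.filter fun φ => φ.1.contains v) X := by
  set scope := scopeOf adj s.1 v with hscope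
  set J := s.2.filter fun φ => φ.1.contains v with hJ
  have hv : v ∉ scope := fun h => ((mem_scopeOf hadj).1 h).2.ne rfl
  -- The value of `best` depends only on the intersection of the kept set with the scope.
  have hcongr : ∀ S ∈ tuples q scope, agree scope S X = true →
      best q v scope J S = best q v scope J X := by
    intro S hS hagree
    rw [agree_iff] at hagree
    have hvS : v ∉ S := fun h => hv ((mem_of_mem_tuples hS).2 v h)
    have hvX : v ∉ X := fun h => (hX v h).2 rfl
    have h1 : ∀ φ ∈ J, ∀ x ∈ φ.1, (x ∈ S ↔ x ∈ X) := by
      intro φ hφ x hx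
      rw [hJ, List.mem_filter] at hφ
      by_cases hxv : x = v
      · subst hxv
        simp [hvS, hvX]
      · refine hagree x ((mem_scopeOf hadj).2 ⟨hs.scope_sub φ hφ.1 x hx, ?_⟩)
        exact hs.scope_clique φ hφ.1 (by simpa using hφ.2) hx (Ne.symm hxv)
    have h2 : lookupAll J S = lookupAll J X := lookupAll_congr h1
    have h3 : lookupAll J (v :: S) = lookupAll J (v :: X) :=
      lookupAll_congr fun φ hφ x hx => by simp [h1 φ hφ x hx]
    have h4 : (scope.filter fun x => S.contains x) = scope.filter fun x => X.contains x :=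
      List.filter_congr fun x hx => by rw [Bool.eq_iff_iff]; simpa using hagree x hx
    simp only [best, h2, h3, h4]
  have hnd : scope.Nodup := hs.nodup.filter _
  have hmem : (scope.filter fun x => X.contains x) ∈ tuples q scope :=
    mem_tuples (length_filter_le hnd hsimp hXq) fun x hx => (List.mem_filter.1 hx).1
  have hagree : agree scope (scope.filter fun x => X.contains x) X = true := by
    rw [agree_iff]
    intro x hx
    simp [hx]
  have hlook : lookup (newFactor adj q s v) X =
      ((((tuples q scope).map fun S => (S, best q v scope J S)).filter
        fun e => agree scope e.1 X).headD ([], [])).2 := rfl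
  rw [hlook]
  cases hl : (((tuples q scope).map fun S => (S, best q v scope J S)).filter
      fun e => agree scope e.1 X) with
  | nil =>
    rw [List.filter_eq_nil_iff] at hl
    exact (hl _ (List.mem_map.2 ⟨_, hmem, rfl⟩) hagree).elim
  | cons e l =>
    have he : e ∈ (((tuples q scope).map fun S => (S, best q v scope J S)).filter
      fun e => agree scope e.1 X) := by rw [hl]; exact List.mem_cons_self
    rw [List.mem_filter, List.mem_map] at he
    obtain ⟨⟨S, hS, rfl⟩, he⟩ := he
    exact hcongr S hS he

/-- A best extension of `X` after the elimination of `v` is either a best extension of `X` or a best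
extension of `X ∪ {v}` together with `v`. The factors without `v` in their scope contribute the same
to both, so that it suffices to compare the contributions of the others. -/
theorem invariant_eliminate (hadj : ∀ i j, adj i j = true ↔ H.Adj i j) (hs : Invariant H q U s)
    {v : ℕ} (hv : v ∈ s.1) (hsimp : H.IsClique {x | x ∈ scopeOf adj s.1 v}) :
    Invariant H q U (eliminate adj q s v) := by
  have hR : ∀ x, x ∈ (eliminate adj q s v).1 ↔ x ∈ s.1 ∧ x ≠ v := by
    simp [eliminate]
  have hvs : v ∉ scopeOf adj s.1 v := fun h => ((mem_scopeOf hadj).1 h).2.ne rfl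
  have hF : ∀ φ, φ ∈ (eliminate adj q s v).2 ↔
      φ = newFactor adj q s v ∨ φ ∈ s.2 ∧ v ∉ φ.1 := by
    simp [eliminate]
  refine ⟨hs.nodup.filter _, fun x hx => hs.sub x ((hR x).1 hx).1, ?_, ?_, ?_⟩
  · intro φ hφ x hx
    rw [hR]
    rcases (hF φ).1 hφ with rfl | ⟨hφ, hvφ⟩
    · have := (mem_scopeOf hadj).1 (show x ∈ scopeOf adj s.1 v from hx)
      exact ⟨this.1, this.2.ne'⟩
    · exact ⟨hs.scope_sub φ hφ x hx, fun h => hvφ (h ▸ hx)⟩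
  · intro φ hφ
    rcases (hF φ).1 hφ with rfl | ⟨hφ, -⟩
    · exact hsimp
    · exact hs.scope_clique φ hφ
  · intro X hX hXq
    simp only [hR] at hX
    set scope := scopeOf adj s.1 v with hscope
    set J := s.2.filter fun φ => φ.1.contains v with hJ
    set K := s.2.filter fun φ => !φ.1.contains v with hK
    have hvX : v ∉ X := fun h => (hX v h).2 rfl
    have hvU : v ∈ U := hs.sub v hv
    have hlook : lookupAll (eliminate adj q s v).2 X =
        best q v scope J X ++ lookupAll K X := by
      rw [← lookup_newFactor hadj hs hsimp hX hXq]
      rfl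
    have hperm : ∀ Y, (lookupAll s.2 Y).Perm (lookupAll J Y ++ lookupAll K Y) := by
      intro Y
      rw [lookupAll, lookupAll, lookupAll, ← List.flatMap_append]
      exact (List.filter_append_perm _ s.2).symm.flatMap_right _
    have hKv : lookupAll K (v :: X) = lookupAll K X := by
      refine lookupAll_congr fun φ hφ x hx => ?_
      have hvφ : v ∉ φ.1 := by simpa using (List.mem_filter.1 hφ).2
      have : x ≠ v := fun h => hvφ (h ▸ hx)
      simp [this]
    -- The best extension of `X` that deletes `v`, and the one that keeps it.
    have hout := hs.extension X (fun x hx => (hX x hx).1) hXq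
    have hin : (scope.filter fun x => X.contains x).length < q →
        CliquesLE H q {x | x ∈ v :: X} := by
      intro hlt t ht htc
      by_cases hvt : v ∈ t
      · have h1 : (t.erase v).card ≤ (scope.filter fun x => X.contains x).length := by
          refine (Finset.card_le_card fun x hx => ?_).trans (List.toFinset_card_le _)
          obtain ⟨hxv, hxt⟩ := Finset.mem_erase.1 hx
          have hxX : x ∈ X := (List.mem_cons.1 (ht hxt)).resolve_left hxv
          simp only [List.mem_toFinset, List.mem_filter, List.contains_iff_mem]
          exact ⟨(mem_scopeOf hadj).2 ⟨(hX x hxX).1, htc hvt hxt hxv.symm⟩, hxX⟩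
        rw [Finset.card_erase_of_mem hvt] at h1
        omega
      · exact hXq t (fun x hx => (List.mem_cons.1 (ht hx)).resolve_left
          fun h => hvt (h ▸ hx)) htc
    have hinX : ∀ x ∈ v :: X, x ∈ s.1 := by
      intro x hx
      rcases List.mem_cons.1 hx with rfl | hx
      · exact hv
      · exact (hX x hx).1
    have hlen : ∀ Y, (lookupAll s.2 Y).length =
        (lookupAll J Y).length + (lookupAll K Y).length := fun Y => by
      rw [(hperm Y).length_eq, List.length_append]
    -- Both alternatives are at most as good as the chosen one.
    have hge : (lookupAll s.2 X).length ≤ (best q v scope J X).length + (lookupAll K X).length := by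
      rw [hlen, best]
      cases h : ((scope.filter fun x => X.contains x).length + 1).ble q &&
        (lookupAll J X).length.ble (v :: lookupAll J (v :: X)).length
      · simp
      · simp only [Bool.and_eq_true, Nat.ble_eq] at h
        simp only [cond_true]
        omega
    have hge' : (scope.filter fun x => X.contains x).length < q →
        (lookupAll s.2 (v :: X)).length + 1 ≤
          (best q v scope J X).length + (lookupAll K X).length := by
      intro hlt
      rw [hlen, hKv, best]
      cases h : ((scope.filter fun x => X.contains x).length + 1).ble q &&
        (lookupAll J X).length.ble (v :: lookupAll J (v :: X)).length
      · rw [Bool.and_eq_false_iff] at h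
        rcases h with h | h
        · rw [Bool.eq_false_iff, ne_eq, Nat.ble_eq] at h
          omega
        · rw [Bool.eq_false_iff, ne_eq, Nat.ble_eq] at h
          simp only [List.length_cons, cond_false] at h ⊢
          omega
      · simp only [cond_true, List.length_cons]
        omega
    have hchoice : (lookupAll (eliminate adj q s v).2 X).Perm (lookupAll s.2 X) ∨
        (scope.filter fun x => X.contains x).length < q ∧
        (lookupAll (eliminate adj q s v).2 X).Perm
          (v :: lookupAll s.2 (v :: X)) := by
      rw [hlook, best]
      cases h : ((scope.filter fun x => X.contains x).length + 1).ble q &&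
        (lookupAll J X).length.ble (v :: lookupAll J (v :: X)).length
      · exact Or.inl (hperm X).symm
      · simp only [Bool.and_eq_true, Nat.ble_eq] at h
        refine Or.inr ⟨h.1, ?_⟩
        have := hperm (v :: X)
        rw [hKv] at this
        simpa using this.symm
    have hle : ∀ W : Finset ℕ, W ⊆ U → CliquesLE H q W →
        (∀ x ∈ (eliminate adj q s v).1, (x ∈ W ↔ x ∈ X)) →
        (W.filter (· ∉ (eliminate adj q s v).1)).card ≤
          (lookupAll (eliminate adj q s v).2 X).length := by
      intro W hWU hWq hW
      simp only [hR] at hW ⊢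
      rw [hlook, List.length_append]
      by_cases hvW : v ∈ W
      · have hlt : (scope.filter fun x => X.contains x).length < q := by
          have hnd : scope.Nodup := hs.nodup.filter _
          rw [← List.toFinset_card_of_nodup (hnd.filter _)]
          have hnot : v ∉ (scope.filter fun x => X.contains x).toFinset := by simp [hvX]
          have := hWq (insert v (scope.filter fun x => X.contains x).toFinset) ?_ ?_
          · rw [Finset.card_insert_of_notMem hnot] at this
            omega
          · intro x hx
            simp only [Finset.coe_insert, List.coe_toFinset, List.mem_filter,
              List.contains_iff_mem, Set.mem_insert_iff, Set.mem_ofPred_eq] at hx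
            rcases hx with rfl | ⟨-, hx⟩
            · exact hvW
            · exact (hW x (hX x hx)).2 hx
          · rw [Finset.coe_insert]
            refine SimpleGraph.IsClique.insert (hsimp.subset fun x hx => ?_) fun x hx _ => ?_
            · simp at hx
              exact hx.1
            · simp at hx
              exact ((mem_scopeOf hadj).1 hx.1).2
        have h1 := (hs.extension (v :: X) hinX (hin hlt)).le W hWU hWq fun x hx => by
          by_cases hxv : x = v
          · simp [hxv, hvW]
          · simpa [hxv] using hW x ⟨hx, hxv⟩
        have h2 : W.filter (fun x => ¬ (x ∈ s.1 ∧ x ≠ v)) = insert v (W.filter (· ∉ s.1)) := by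
          ext x
          by_cases hxv : x = v
          · simp [hxv, hvW]
          · simp [hxv]
        rw [h2]
        refine (Finset.card_insert_le _ _).trans ?_
        have := hge' hlt
        omega
      · have h1 := hout.le W hWU hWq fun x hx => by
          by_cases hxv : x = v
          · simp [hxv, hvW, hvX]
          · exact hW x ⟨hx, hxv⟩
        have h2 : W.filter (fun x => ¬ (x ∈ s.1 ∧ x ≠ v)) = W.filter (· ∉ s.1) := by
          refine Finset.filter_congr fun x hx => ?_
          have : x ≠ v := fun h => hvW (h ▸ hx)
          simp [this]
        rw [h2]
        omega
    rcases hchoice with hp | ⟨hlt, hp⟩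
    · refine ⟨hp.nodup_iff.2 hout.nodup, fun w hw => ?_, ?_, hle⟩
      · have := hout.mem w (hp.mem_iff.1 hw)
        exact ⟨this.1, fun h => this.2 ((hR w).1 h).1⟩
      · exact hout.cliquesLE.mono fun x hx => hx.imp (fun h => h) hp.mem_iff.1
    · have hin' := hs.extension (v :: X) hinX (hin hlt)
      refine ⟨hp.nodup_iff.2 (List.nodup_cons.2 ⟨fun h => (hin'.mem v h).2 hv, hin'.nodup⟩),
        fun w hw => ?_, ?_, hle⟩
      · rcases List.mem_cons.1 (hp.mem_iff.1 hw) with rfl | hw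
        · exact ⟨hvU, fun h => ((hR w).1 h).2 rfl⟩
        · have := hin'.mem w hw
          exact ⟨this.1, fun h => this.2 ((hR w).1 h).1⟩
      · refine hin'.cliquesLE.mono fun x hx => ?_
        rcases hx with hx | hx
        · exact Or.inl (List.mem_cons_of_mem _ hx)
        · rcases List.mem_cons.1 (hp.mem_iff.1 hx) with rfl | hx
          · exact Or.inl List.mem_cons_self
          · exact Or.inr hx

theorem isSimplicial_iff (hadj : ∀ i j, adj i j = true ↔ H.Adj i j) {R : List ℕ} {v : ℕ} :
    isSimplicial adj R v = true ↔ SimplicialIn H R.toFinset v := by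
  simp only [isSimplicial, List.all_eq_true, SimplicialIn, List.mem_toFinset]
  refine forall₂_congr fun x hx => forall₂_congr fun y hy => ?_
  rw [← hadj, ← hadj, ← hadj]
  by_cases hxy : x = y
  · simp [hxy]
  · cases adj v x <;> cases adj v y <;> cases adj x y <;> simp [hxy]

theorem invariant_elimAll (hadj : ∀ i j, adj i j = true ↔ H.Adj i j) {n : ℕ}
    (hU : U = Finset.range n)
    (hsimp : ∀ R ⊆ U, R.Nonempty → ∃ v ∈ R, SimplicialIn H R v) :
    Invariant H q U (elimAll adj q n) ∧ (elimAll adj q n).1 = [] := by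
  have key : ∀ (k : ℕ) (s : ElimState), Invariant H q U s → s.1.length ≤ k →
      ∀ l : List ℕ, l.length = k →
      Invariant H q U (l.foldl (fun s _ => elimStep adj q s) s) ∧
        (l.foldl (fun s _ => elimStep adj q s) s).1 = [] := by
    intro k
    induction k with
    | zero =>
      intro s hs hk l hl
      rw [List.length_eq_zero_iff] at hl
      subst hl
      exact ⟨hs, by simpa using hk⟩
    | succ k ih =>
      intro s hs hk l hl
      rcases l with _ | ⟨x, l⟩
      · simp at hl
      rw [List.foldl_cons]
      have hl' : l.length = k := by simpa using hl
      cases hf : s.1.filter (isSimplicial adj s.1) with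
      | nil =>
        have hst : elimStep adj q s = s := by simp [elimStep, hf]
        rw [hst]
        refine ih s hs ?_ l hl'
        by_contra hne
        obtain ⟨v, hv, hvs⟩ := hsimp s.1.toFinset
          (fun x hx => hs.sub x (List.mem_toFinset.1 hx))
          (by
            rw [List.toFinset_nonempty_iff]
            rintro h
            simp [h] at hne)
        rw [List.filter_eq_nil_iff] at hf
        exact hf v (List.mem_toFinset.1 hv) ((isSimplicial_iff hadj).2 hvs)
      | cons v l' =>
        have hst : elimStep adj q s = eliminate adj q s v := by simp [elimStep, hf]
        have hv : v ∈ s.1.filter (isSimplicial adj s.1) := by rw [hf]; exact List.mem_cons_self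
        rw [List.mem_filter, isSimplicial_iff hadj] at hv
        rw [hst]
        refine ih _ (invariant_eliminate hadj hs hv.1 fun x hx y hy hxy => ?_) ?_ l hl'
        · have hx := (mem_scopeOf hadj).1 hx
          have hy := (mem_scopeOf hadj).1 hy
          exact hv.2 x (List.mem_toFinset.2 hx.1) y (List.mem_toFinset.2 hy.1) hx.2 hy.2 hxy
        · have : (eliminate adj q s v).1.length < s.1.length :=
            List.length_filter_lt_length_iff_exists.2 ⟨v, hv.1, by simp⟩
          omega
  refine key n _ ⟨List.nodup_range, by simp [hU], by simp, by simp, fun X hX hXq => ?_⟩ (by simp) _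
    (by simp)
  refine ⟨by simp [lookupAll], by simp [lookupAll], by simpa [lookupAll] using hXq, ?_⟩
  intro W hW _ _
  simp only [lookupAll, List.flatMap_nil, List.length_nil, Nat.le_zero, Finset.card_eq_zero,
    Finset.filter_eq_empty_iff, List.mem_range, not_not]
  intro x hx
  simpa [hU] using hW hx

/-- The algorithm finds a largest set of vertices without large cliques, if every nonempty set of
vertices contains a simplicial vertex. -/
theorem isBestExtension_solve (hadj : ∀ i j, adj i j = true ↔ H.Adj i j) {n : ℕ}
    (hsimp : ∀ R ⊆ Finset.range n, R.Nonempty → ∃ v ∈ R, SimplicialIn H R v) :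
    IsBestExtension H q (Finset.range n) [] [] (solve adj q n) := by
  obtain ⟨hinv, hnil⟩ := invariant_elimAll (q := q) hadj rfl hsimp
  have := hinv.extension [] (by simp) fun t ht _ => by
    have : t = ∅ := by simpa using ht
    simp [this]
  rwa [hnil] at this

end VertexDeletion

namespace VertexDeletion

open StackProgram

/-! ### Running time of the elimination algorithm -/

section Operations

variable {α : Type} [Enc α]

theorem polyTime_agree {f g h : α → List ℕ} (hf : PolyTime f) (hg : PolyTime g)
    (hh : PolyTime h) : PolyTime fun a => agree (f a) (g a) (h a) :=
  hf.all (.beq_bool (.contains (hg.comp (.fst .id)) (.snd .id))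
    (.contains (hh.comp (.fst .id)) (.snd .id)))

theorem polyTime_lookup {f : α → Factor} {g : α → List ℕ} (hf : PolyTime f) (hg : PolyTime g) :
    PolyTime fun a => lookup (f a) (g a) :=
  .snd (.headD (.filter (p := fun a e => agree (f a).1 e.1 (g a)) (.snd hf)
    (polyTime_agree (.fst (hf.comp (.fst .id))) (.fst (.snd .id)) (hg.comp (.fst .id))))
    (.const ([], [])))

theorem polyTime_lookupAll {f : α → List Factor} {g : α → List ℕ} (hf : PolyTime f)
    (hg : PolyTime g) : PolyTime fun a => lookupAll (f a) (g a) :=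
  .flatMap (g := fun a φ => lookup φ (g a)) hf (polyTime_lookup (.snd .id) (hg.comp (.fst .id)))

theorem polyTime_tuples (k : ℕ) {f : α → List ℕ} (hf : PolyTime f) :
    PolyTime fun a => tuples k (f a) := by
  induction k with
  | zero => exact .const [[]]
  | succ k ih =>
    exact .flatMap (g := fun a S => S :: (f a).map fun x => x :: S) ih
      (.cons (.snd .id) (.map (g := fun (y : α × List ℕ) x => x :: y.2) (hf.comp (.fst .id))
        (.cons (.snd .id) (.snd (.fst .id)))))

theorem polyTime_best (q : ℕ) {v : α → ℕ} {f : α → List ℕ} {g : α → List Factor}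
    {h : α → List ℕ} (hv : PolyTime v) (hf : PolyTime f) (hg : PolyTime g) (hh : PolyTime h) :
    PolyTime fun a => best q (v a) (f a) (g a) (h a) := by
  have h1 := polyTime_lookupAll hg hh
  have h2 := PolyTime.cons hv (polyTime_lookupAll hg (.cons hv hh))
  refine .cond (.and (.ble (.add (.length (.filter (p := fun a x => (h a).contains x) hf
    (.contains (hh.comp (.fst .id)) (.snd .id)))) (.const 1)) (.const q))
    (.ble (.length h1) (.length h2))) h2 h1

end Operations

/-- The adjacency relation that is given by the first `n ^ 2` bits of a word; it is extended by
`false` outside of `{0, …, n - 1}`. -/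
def adjOf (e : List Bool × ℕ) (i j : ℕ) : Bool :=
  (i + 1).ble e.2 && (j + 1).ble e.2 && (e.1.drop (i * e.2 + j)).headD false

section Steps

variable {α : Type} [Enc α] {e : α → List Bool × ℕ}

theorem polyTime_adjOf {i j : α → ℕ} (he : PolyTime e) (hi : PolyTime i) (hj : PolyTime j) :
    PolyTime fun a => adjOf (e a) (i a) (j a) :=
  .and (.and (.ble (.add hi (.const 1)) (.snd he)) (.ble (.add hj (.const 1)) (.snd he)))
    (.headD (.drop (.add (.mul hi (.snd he)) hj) (.fst he)) (.const false))

theorem polyTime_isSimplicial {f : α → List ℕ} {v : α → ℕ} (he : PolyTime e) (hf : PolyTime f)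
    (hv : PolyTime v) : PolyTime fun a => isSimplicial (adjOf (e a)) (f a) (v a) := by
  have he' : PolyTime fun x : (α × ℕ) × ℕ => e x.1.1 := he.comp (.fst (.fst .id))
  have hv' : PolyTime fun x : (α × ℕ) × ℕ => v x.1.1 := hv.comp (.fst (.fst .id))
  have hx : PolyTime fun x : (α × ℕ) × ℕ => x.1.2 := .snd (.fst .id)
  have hy : PolyTime fun x : (α × ℕ) × ℕ => x.2 := .snd .id
  exact .all (p := fun a x => (f a).all fun y =>
      !(adjOf (e a) (v a) x && adjOf (e a) (v a) y && !(x == y)) || adjOf (e a) x y) hf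
    (.all (p := fun (z : α × ℕ) y => !(adjOf (e z.1) (v z.1) z.2 && adjOf (e z.1) (v z.1) y &&
      !(z.2 == y)) || adjOf (e z.1) z.2 y) (hf.comp (.fst .id))
      (.or (.not (.and (.and (polyTime_adjOf he' hv' hx) (polyTime_adjOf he' hv' hy))
        (.not (.beq hx hy)))) (polyTime_adjOf he' hx hy)))

theorem polyTime_scopeOf {f : α → List ℕ} {v : α → ℕ} (he : PolyTime e) (hf : PolyTime f)
    (hv : PolyTime v) : PolyTime fun a => scopeOf (adjOf (e a)) (f a) (v a) :=
  .filter (p := fun a x => adjOf (e a) (v a) x && !(x == v a)) hf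
    (.and (polyTime_adjOf (he.comp (.fst .id)) (hv.comp (.fst .id)) (.snd .id))
      (.not (.beq (.snd .id) (hv.comp (.fst .id)))))

theorem polyTime_newFactor (q : ℕ) {f : α → ElimState} {v : α → ℕ} (he : PolyTime e)
    (hf : PolyTime f) (hv : PolyTime v) :
    PolyTime fun a => newFactor (adjOf (e a)) q (f a) (v a) := by
  have hs := polyTime_scopeOf he (.fst hf) hv
  have hJ : PolyTime fun a => (f a).2.filter fun φ => φ.1.contains (v a) :=
    .filter (p := fun a (φ : Factor) => φ.1.contains (v a)) (.snd hf)
      (.contains (.fst (.snd .id)) (hv.comp (.fst .id)))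
  exact .prod hs (.map (g := fun a S => (S, best q (v a) (scopeOf (adjOf (e a)) (f a).1 (v a))
    ((f a).2.filter fun φ => φ.1.contains (v a)) S)) (polyTime_tuples q hs)
    (.prod (.snd .id) (polyTime_best q (hv.comp (.fst .id)) (hs.comp (.fst .id))
      (hJ.comp (.fst .id)) (.snd .id))))

theorem polyTime_eliminate (q : ℕ) {f : α → ElimState} {v : α → ℕ} (he : PolyTime e)
    (hf : PolyTime f) (hv : PolyTime v) :
    PolyTime fun a => eliminate (adjOf (e a)) q (f a) (v a) :=
  .prod (.filter (p := fun a x => !(x == v a)) (.fst hf)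
      (.not (.beq (.snd .id) (hv.comp (.fst .id)))))
    (.cons (polyTime_newFactor q he hf hv)
      (.filter (p := fun a (φ : Factor) => !φ.1.contains (v a)) (.snd hf)
        (.not (.contains (.fst (.snd .id)) (hv.comp (.fst .id))))))

theorem polyTime_elimStep (q : ℕ) {f : α → ElimState} (he : PolyTime e) (hf : PolyTime f) :
    PolyTime fun a => elimStep (adjOf (e a)) q (f a) := by
  have hs : PolyTime fun a => (f a).1.filter (isSimplicial (adjOf (e a)) (f a).1) :=
    .filter (p := fun a v => isSimplicial (adjOf (e a)) (f a).1 v) (.fst hf)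
      (polyTime_isSimplicial (he.comp (.fst .id)) (.fst (hf.comp (.fst .id))) (.snd .id))
  refine .cases_list (h := fun x => eliminate (adjOf (e x.2)) q (f x.2) x.1.1) hs hf
    (polyTime_eliminate q (he.comp (.snd .id)) (hf.comp (.snd .id)) (.fst (.fst .id)))
    (fun a h => ?_) (fun a v l h => ?_)
  · simp only [elimStep, h]
  · simp only [elimStep, h]

end Steps

/-- The largest number of vertices in an entry of the table of a factor. -/
def weight (φ : Factor) : ℕ := (φ.2.map fun e => e.2.length).foldr max 0

theorem length_le_weight {φ : Factor} {e : List ℕ × List ℕ} (he : e ∈ φ.2) :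
    e.2.length ≤ weight φ := by
  unfold weight
  revert he
  generalize φ.2 = t
  intro he
  induction t with
  | nil => simp at he
  | cons d l ih =>
    rcases List.mem_cons.1 he with rfl | he
    · simp
    · exact (ih he).trans (by simp)

theorem weight_le {φ : Factor} {m : ℕ} (h : ∀ e ∈ φ.2, e.2.length ≤ m) : weight φ ≤ m := by
  unfold weight
  revert h
  generalize φ.2 = t
  intro h
  induction t with
  | nil => simp
  | cons d l ih =>
    simp only [List.map_cons, List.foldr_cons, max_le_iff]
    exact ⟨h d List.mem_cons_self, ih fun e he => h e (List.mem_cons_of_mem _ he)⟩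

theorem lookup_mem (φ : Factor) (X : List ℕ) :
    lookup φ X = [] ∨ ∃ e ∈ φ.2, lookup φ X = e.2 := by
  unfold lookup
  cases h : φ.2.filter fun e => agree φ.1 e.1 X with
  | nil => exact Or.inl rfl
  | cons e l =>
    have : e ∈ φ.2.filter fun e => agree φ.1 e.1 X := by rw [h]; exact List.mem_cons_self
    exact Or.inr ⟨e, (List.mem_filter.1 this).1, rfl⟩

theorem length_lookupAll_le (F : List Factor) (X : List ℕ) :
    (lookupAll F X).length ≤ (F.map weight).sum := by
  induction F with
  | nil => simp [lookupAll]
  | cons φ F ih =>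
    have : (lookup φ X).length ≤ weight φ := by
      rcases lookup_mem φ X with h | ⟨e, he, h⟩
      · simp [h]
      · exact h ▸ length_le_weight he
    simp only [lookupAll, List.flatMap_cons, List.length_append, List.map_cons,
      List.sum_cons] at ih ⊢
    omega

theorem length_tuples (k : ℕ) (l : List ℕ) : (tuples k l).length = (l.length + 1) ^ k := by
  induction k with
  | zero => rfl
  | succ k ih => simp [tuples, ih, pow_succ]

/-- A bound on the sizes of the parts of a factor for a graph on `n` vertices. -/
structure FactorBounded (q n : ℕ) (φ : Factor) : Prop where
  scope_length : φ.1.length ≤ n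
  scope_lt : ∀ x ∈ φ.1, x < n
  table_length : φ.2.length ≤ (n + 1) ^ q
  key_length : ∀ e ∈ φ.2, e.1.length ≤ q
  key_lt : ∀ e ∈ φ.2, ∀ x ∈ e.1, x < n
  entry_lt : ∀ e ∈ φ.2, ∀ x ∈ e.2, x < n

/-- A bound on the sizes of the parts of the state after at most `k` eliminations. The total weight
of the factors increases by at most one in each elimination, since the factors that are combined
into a new one disappear. -/
structure StateBounded (q n k : ℕ) (s : ElimState) : Prop where
  length : s.1.length ≤ n
  lt : ∀ x ∈ s.1, x < n
  factors_length : s.2.length ≤ k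
  weight_sum : (s.2.map weight).sum ≤ k
  factor : ∀ φ ∈ s.2, FactorBounded q n φ

theorem StateBounded.eliminate {q n k : ℕ} {s : ElimState} (hs : StateBounded q n k s)
    (adj : ℕ → ℕ → Bool) {v : ℕ} (hv : v ∈ s.1) :
    StateBounded q n (k + 1) (eliminate adj q s v) := by
  have hsc : (scopeOf adj s.1 v).length ≤ n := (List.length_filter_le _ _).trans hs.length
  have hsl : ∀ x ∈ scopeOf adj s.1 v, x < n := fun x hx => hs.lt x (List.mem_filter.1 hx).1
  have hlook : ∀ X, ∀ x ∈ lookupAll (s.2.filter fun φ => φ.1.contains v) X, x < n := by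
    intro X x hx
    obtain ⟨φ, hφ, hx⟩ := List.mem_flatMap.1 hx
    rcases lookup_mem φ X with h | ⟨e, he, h⟩
    · simp [h] at hx
    · exact (hs.factor φ (List.mem_filter.1 hφ).1).entry_lt e he x (h ▸ hx)
  have hbest : ∀ S, (∀ x ∈ best q v (scopeOf adj s.1 v)
        (s.2.filter fun φ => φ.1.contains v) S, x < n) ∧
      (best q v (scopeOf adj s.1 v) (s.2.filter fun φ => φ.1.contains v) S).length ≤
        ((s.2.filter fun φ => φ.1.contains v).map weight).sum + 1 := by
    intro S
    unfold best
    have h1 := length_lookupAll_le (s.2.filter fun φ => φ.1.contains v) S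
    have h2 := length_lookupAll_le (s.2.filter fun φ => φ.1.contains v) (v :: S)
    cases _ && _
    · exact ⟨hlook S, by simp only [cond_false]; omega⟩
    · refine ⟨fun x hx => ?_, by simp only [cond_true, List.length_cons]; omega⟩
      rcases List.mem_cons.1 hx with rfl | hx
      · exact hs.lt _ hv
      · exact hlook _ x hx
  refine ⟨(List.length_filter_le _ _).trans hs.length,
    fun x hx => hs.lt x (List.mem_filter.1 hx).1, ?_, ?_, fun φ hφ => ?_⟩
  · exact Nat.succ_le_succ ((List.length_filter_le _ _).trans hs.factors_length)
  · have h1 : weight (newFactor adj q s v) ≤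
        ((s.2.filter fun φ => φ.1.contains v).map weight).sum + 1 := by
      refine weight_le fun e he => ?_
      obtain ⟨S, -, rfl⟩ := List.mem_map.1 he
      exact (hbest S).2
    have h2 := ((List.filter_append_perm (fun φ : Factor => φ.1.contains v) s.2).map
      weight).sum_eq
    have h3 := hs.weight_sum
    rw [List.map_append, List.sum_append] at h2
    simp only [VertexDeletion.eliminate, List.map_cons, List.sum_cons]
    omega
  · rcases List.mem_cons.1 hφ with rfl | hφ
    · refine ⟨hsc, hsl, ?_, fun e he => ?_, fun e he x hx => ?_, fun e he => ?_⟩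
      · simp only [newFactor, List.length_map, length_tuples]
        gcongr
      all_goals obtain ⟨S, hS, rfl⟩ := List.mem_map.1 he
      · exact (mem_of_mem_tuples hS).1
      · exact hsl x ((mem_of_mem_tuples hS).2 x hx)
      · exact (hbest S).1
    · exact hs.factor φ (List.mem_filter.1 hφ).1

theorem StateBounded.mono {q n k k' : ℕ} {s : ElimState} (hs : StateBounded q n k s)
    (h : k ≤ k') : StateBounded q n k' s :=
  ⟨hs.length, hs.lt, hs.factors_length.trans h, hs.weight_sum.trans h, hs.factor⟩

theorem StateBounded.elimStep {q n k : ℕ} {s : ElimState} (hs : StateBounded q n k s)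
    (adj : ℕ → ℕ → Bool) : StateBounded q n (k + 1) (elimStep adj q s) := by
  unfold VertexDeletion.elimStep
  cases h : s.1.filter (isSimplicial adj s.1) with
  | nil => exact hs.mono (Nat.le_succ k)
  | cons v l =>
    have hv : v ∈ s.1.filter (isSimplicial adj s.1) := by rw [h]; exact List.mem_cons_self
    exact hs.eliminate adj (List.mem_filter.1 hv).1

theorem stateBounded_foldl (adj : ℕ → ℕ → Bool) (q n : ℕ) (l : List ℕ) :
    StateBounded q n l.length (l.foldl (fun s _ => elimStep adj q s) (List.range n, [])) := by
  induction l using List.reverseRecOn with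
  | nil => exact ⟨by simp, by simp, by simp, by simp, by simp⟩
  | append_singleton l x ih =>
    rw [List.foldl_append, List.length_append]
    exact ih.elimStep adj

theorem size_list_nat_le {l : List ℕ} {m n : ℕ} (hl : l.length ≤ m) (h : ∀ x ∈ l, x < n) :
    size l ≤ m * (2 * n + 2) + 1 :=
  (size_le_of_forall_mem (m := 2 * n + 1) fun x hx => by
    have := h x hx
    rw [size_nat]
    omega).trans (by gcongr)

/-- A polynomial bound on the size of a factor. -/
noncomputable def factorPoly (q : ℕ) : Polynomial ℕ :=
  (.X * (2 * .X + 2) + 1) + ((.X + 1) ^ q *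
    ((Polynomial.C q * (2 * .X + 2) + 1) + (.X * (2 * .X + 2) + 1) + 1 + 1) + 1) + 1

/-- A polynomial bound on the size of a state. -/
noncomputable def statePoly (q : ℕ) : Polynomial ℕ :=
  (.X * (2 * .X + 2) + 1) + (.X * (factorPoly q + 1) + 1) + 1

theorem StateBounded.size_le {q n k : ℕ} {s : ElimState} (hs : StateBounded q n k s)
    (hk : k ≤ n) : size s ≤ (statePoly q).eval n := by
  have hF : ∀ φ ∈ s.2, size φ ≤ (factorPoly q).eval n := by
    intro φ hφ
    have hb := hs.factor φ hφ
    have hw : weight φ ≤ n := (List.single_le_sum (by simp) _ (List.mem_map_of_mem hφ)).trans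
      (hs.weight_sum.trans hk)
    have h1 := size_list_nat_le hb.scope_length hb.scope_lt
    have h2 := size_le_of_forall_mem (l := φ.2) (m := (q * (2 * n + 2) + 1) +
      (n * (2 * n + 2) + 1) + 1) fun e he => by
        have h3 := size_list_nat_le (hb.key_length e he) (hb.key_lt e he)
        have h4 := size_list_nat_le ((length_le_weight he).trans hw) (hb.entry_lt e he)
        have h5 : size e = size e.1 + size e.2 + 1 := size_prod e.1 e.2
        omega
    have h6 := Nat.mul_le_mul_right ((q * (2 * n + 2) + 1) + (n * (2 * n + 2) + 1) + 1 + 1)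
      hb.table_length
    have h7 : size φ = size φ.1 + size φ.2 + 1 := size_prod φ.1 φ.2
    simp only [factorPoly, Polynomial.eval_add, Polynomial.eval_mul, Polynomial.eval_X,
      Polynomial.eval_pow, Polynomial.eval_C, Polynomial.eval_one, Polynomial.eval_ofNat]
    omega
  have h1 := size_list_nat_le hs.length hs.lt
  have h2 := size_le_of_forall_mem hF
  have h3 := Nat.mul_le_mul_right ((factorPoly q).eval n + 1) (hs.factors_length.trans hk)
  have h4 : size s = size s.1 + size s.2 + 1 := size_prod s.1 s.2
  simp only [statePoly, Polynomial.eval_add, Polynomial.eval_mul, Polynomial.eval_X,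
    Polynomial.eval_one, Polynomial.eval_ofNat]
  omega

theorem polyTime_solve (q : ℕ) :
    PolyTime fun e : List Bool × ℕ => solve (adjOf e) q e.2 := by
  have hr : PolyTime fun e : List Bool × ℕ => List.range e.2 := .range (.snd .id)
  refine polyTime_lookupAll (.snd (.foldl (h := fun e s _ => elimStep (adjOf e) q s) hr
    (.prod hr (.const [])) (polyTime_elimStep q (.fst (.fst .id)) (.snd (.fst .id)))
    (statePoly q) fun e l hl => ?_)) (.const [])
  have h1 : l.length ≤ e.2 := by simpa using hl.length_le
  refine ((stateBounded_foldl (adjOf e) q e.2 l).size_le h1).trans (eval_mono _ ?_)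
  have h2 : size e = size e.1 + size e.2 + 1 := size_prod e.1 e.2
  rw [size_nat] at h2
  omega

/-- The number of vertices of a graph, computed from the length of its adjacency matrix. -/
def dimOf (l : List Bool) : ℕ :=
  ((List.range l.length).filter fun i => ((i + 1) * (i + 1)).ble l.length).length

theorem dimOf_eq {l : List Bool} {n : ℕ} (h : l.length = n * n) : dimOf l = n := by
  rw [dimOf, ← List.toFinset_card_of_nodup (List.nodup_range.filter _), h]
  have : ((List.range (n * n)).filter fun i => ((i + 1) * (i + 1)).ble (n * n)).toFinset =
      Finset.range n := by
    ext i
    simp only [List.mem_toFinset, List.mem_filter, List.mem_range, Nat.ble_eq, Finset.mem_range]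
    constructor
    · rintro ⟨-, h⟩
      exact Nat.mul_self_le_mul_self_iff.1 h
    · intro h
      exact ⟨by nlinarith, Nat.mul_self_le_mul_self h⟩
  rw [this, Finset.card_range]

/-- The characteristic word of the complement of the set that the algorithm finds. -/
def deletionWord (q : ℕ) (l : List Bool) : List Bool :=
  (List.range (dimOf l)).map fun i => !(solve (adjOf (l, dimOf l)) q (dimOf l)).contains i

theorem polyTime_deletionWord (q : ℕ) : PolyTime (deletionWord q) := by
  have hl : PolyTime fun l : List Bool => l.length := .length .id
  have hd : PolyTime dimOf := .length (.filter
    (p := fun (l : List Bool) i => ((i + 1) * (i + 1)).ble l.length) (.range hl)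
    (.ble (.mul (.add (.snd .id) (.const 1)) (.add (.snd .id) (.const 1))) (hl.comp (.fst .id))))
  have hs : PolyTime fun l : List Bool => solve (adjOf (l, dimOf l)) q (dimOf l) :=
    (polyTime_solve q).comp (.prod .id hd)
  exact .map (g := fun l i => !(solve (adjOf (l, dimOf l)) q (dimOf l)).contains i) (.range hd)
    (.not (.contains (hs.comp (.fst .id)) (.snd .id)))

end VertexDeletion

namespace StackProgram

open Prog Function

/-! ### From words of bits to trees and back -/

/-- Replace the input word by its representation as a list of truth values. -/
def readInput : Prog :=
  seq (move .main .aux₁) <| seq (push .main false) <|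
  drain .aux₁
    (seq (push .main false) (seq (push .main false) (seq (push .main true) (push .main true))))
    (seq (push .main false) (push .main true))

theorem run_readInput (l : List Bool) :
    ∃ t ≤ 10 * l.length + 3, Run readInput (st l [] [] []) (st (word l) [] [] []) t := by
  obtain ⟨t₁, ht₁, h₁⟩ := run_move_main_aux₁ l [] [] []
  obtain ⟨t₂, ht₂, h₂⟩ := run_drain (k := .aux₁)
    (p := seq (push .main false) (seq (push .main false) (seq (push .main true) (push .main true))))
    (q := seq (push .main false) (push .main true))
    (S := fun w l => st (word w) l [] []) (by simp) (by simp)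
    (fun _ _ => ⟨1 + (1 + (1 + 1)), by simp, (run_push_main _ _ _ _ _).seq
      ((run_push_main _ _ _ _ _).seq ((run_push_main _ _ _ _ _).seq (run_push_main _ _ _ _ _)))⟩)
    (fun _ _ => ⟨1 + 1, by simp, (run_push_main _ _ _ _ _).seq (run_push_main _ _ _ _ _)⟩)
    l.reverse []
  simp only [List.reverse_reverse, List.append_nil, List.length_reverse] at h₁ h₂ ht₂
  exact ⟨t₁ + (1 + t₂), by omega, h₁.seq ((run_push_main _ _ _ _ _).seq h₂)⟩

/-- Replace the representation of a list of truth values by the word of these values. -/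
def writeOutput : Prog :=
  seq (whileTrue .main
    (popCase .main (seq pop (seq pop (push .aux₁ true))) (push .aux₁ false)))
  (move .aux₁ .main)

theorem run_writeOutput (l : List Bool) :
    ∃ t ≤ 15 * l.length + 3, Run writeOutput (st (word l) [] [] []) (st l [] [] []) t := by
  have key : ∀ l a : List Bool, ∃ t ≤ 10 * l.length + 1, Run (whileTrue .main
      (popCase .main (seq pop (seq pop (push .aux₁ true))) (push .aux₁ false)))
      (st (word l) a [] []) (st [] (l.reverse ++ a) [] []) t := by
    intro l
    induction l with
    | nil =>
      intro a
      refine ⟨1, by simp, ?_⟩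
      simpa using Run.while_false (k := .main) (s := st (word ([] : List Bool)) a [] []) (l := [])
        (by simp)
    | cons b l ih =>
      intro a
      obtain ⟨t, ht, h⟩ := ih (b :: a)
      cases b with
      | false =>
        refine ⟨1 + ((1 + 1) + t), by simp; omega, ?_⟩
        rw [List.reverse_cons, List.append_assoc]
        refine Run.while_true (l := false :: word l) (by simp [word_cons]) ?_ h
        rw [update_main]
        refine Run.pop_false (l := word l) (by simp) ?_
        rw [update_main]
        exact run_push_aux₁ _ _ _ _ _
      | true =>
        have hpop : ∀ v m, Run pop (st (v :: m) a [] []) (st m a [] []) (1 + 1) := by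
          intro v m
          cases v
          · refine Run.pop_false (l := m) (by simp) ?_
            rw [update_main]
            exact Run.skip _
          · refine Run.pop_true (l := m) (by simp) ?_
            rw [update_main]
            exact Run.skip _
        refine ⟨1 + ((1 + ((1 + 1) + ((1 + 1) + 1))) + t), by simp; omega, ?_⟩
        rw [List.reverse_cons, List.append_assoc]
        refine Run.while_true (l := true :: false :: false :: word l) (by simp [word_cons]) ?_ h
        rw [update_main]
        refine Run.pop_true (l := false :: false :: word l) (by simp) ?_
        rw [update_main]
        exact (hpop _ _).seq ((hpop _ _).seq (run_push_aux₁ _ _ _ _ _))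
  obtain ⟨t₁, ht₁, h₁⟩ := key l []
  obtain ⟨t₂, ht₂, h₂⟩ := run_move_aux₁_main [] l.reverse [] []
  simp only [List.append_nil, List.reverse_reverse, List.length_reverse] at h₁ h₂ ht₂
  exact ⟨t₁ + t₂, by omega, h₁.seq h₂⟩

/-- A function on words that is computed by a stack program in polynomial time is computed by a
Turing machine in polynomial time. -/
theorem PolyTime.computable {α : Type} {ea f : α → List Bool} {g : List Bool → List Bool}
    (hg : PolyTime g) (h : ∀ a, f a = g (ea a)) :
    Nonempty (Turing.TM2ComputableInPolyTime ea (_root_.id : List Bool → List Bool) f) := by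
  obtain ⟨p, P, hp⟩ := hg
  refine polyTime_of_run (seq readInput (seq p writeOutput))
    (10 * .X + 6 + 16 * P.comp (4 * .X + 1)) fun a => ?_
  have hs : size (ea a) ≤ 4 * (ea a).length + 1 := by
    have := size_le_of_forall_mem (l := ea a) (m := 3) fun b _ => size_bool_le b
    omega
  have hm := eval_mono P hs
  obtain ⟨t₁, ht₁, h₁⟩ := run_readInput (ea a)
  obtain ⟨t₂, ht₂, h₂⟩ := (hp (ea a)).1 []
  obtain ⟨t₃, ht₃, h₃⟩ := run_writeOutput (g (ea a))
  have hl := (length_le_size (g (ea a))).trans (hp (ea a)).2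
  simp only [List.append_nil] at h₂
  rw [h]
  refine ⟨t₁ + (t₂ + t₃), ?_, h₁.seq (h₂.seq h₃)⟩
  simp only [Polynomial.eval_add, Polynomial.eval_mul, Polynomial.eval_comp, Polynomial.eval_X,
    Polynomial.eval_ofNat, Polynomial.eval_one]
  omega

end StackProgram

namespace VertexDeletion

/-! ### Vertex deletion sets of finite graphs -/

variable {n : ℕ} (G : SimpleGraph (Fin n))

theorem getElem?_flatMap {α β : Type} {f : α → List β} {m : ℕ} (hf : ∀ a, (f a).length = m)
    (l : List α) (i j : ℕ) (hj : j < m) :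
    (l.flatMap f)[i * m + j]? = l[i]?.bind fun a => (f a)[j]? := by
  induction l generalizing i with
  | nil => simp
  | cons a l ih =>
    rw [List.flatMap_cons]
    cases i with
    | zero => rw [List.getElem?_append_left (by rw [hf]; omega)]; simp
    | succ i =>
      have h : (i + 1) * m + j = m + (i * m + j) := by ring
      rw [List.getElem?_append_right (by rw [hf]; omega), hf, h, Nat.add_sub_cancel_left, ih]
      simp

theorem length_encodeGraph : (encodeGraph G).length = n * n := by
  simp [encodeGraph]

theorem adjOf_encodeGraph (i j : ℕ) :
    adjOf (encodeGraph G, n) i j = true ↔ (G.map Fin.valEmbedding).Adj i j := by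
  classical
  have hlt : ∀ {i j}, (G.map Fin.valEmbedding).Adj i j → i < n := by
    rintro i j ⟨_, a, b, -, rfl, rfl⟩
    exact a.2
  by_cases hi : i < n
  · by_cases hj : j < n
    · have h1 : (encodeGraph G)[i * n + j]? = some (decide (G.Adj ⟨i, hi⟩ ⟨j, hj⟩)) := by
        rw [encodeGraph, getElem?_flatMap (by simp) _ _ _ hj]
        simp [hi, hj]
      have h2 : (G.map Fin.valEmbedding).Adj i j ↔ G.Adj ⟨i, hi⟩ ⟨j, hj⟩ :=
        SimpleGraph.map_adj_apply (f := Fin.valEmbedding) (a := ⟨i, hi⟩) (b := ⟨j, hj⟩)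
      rw [h2]
      simp [adjOf, List.headD_eq_head?_getD, List.head?_drop, h1, hi, hj]
    · refine iff_of_false ?_ fun h => hj (hlt h.symm)
      simp [adjOf, hj]
  · refine iff_of_false ?_ fun h => hi (hlt h)
    simp [adjOf, hi]

theorem exists_simplicial_map {G : SimpleGraph (Fin n)} (hG : Chordal G) (R : Finset ℕ)
    (hR : R ⊆ Finset.range n) (hne : R.Nonempty) :
    ∃ v ∈ R, SimplicialIn (G.map Fin.valEmbedding) R v := by
  obtain ⟨v, hv⟩ := hne
  obtain ⟨c, hc, hs⟩ := hG.exists_simplicial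
    (A := Finset.univ.filter fun i : Fin n => (i : ℕ) ∈ R)
    ⟨⟨v, Finset.mem_range.1 (hR hv)⟩, by simpa using hv⟩
  refine ⟨c, by simpa using hc, fun x hx y hy hcx hcy hxy => ?_⟩
  lift x to Fin n using Finset.mem_range.1 (hR hx)
  lift y to Fin n using Finset.mem_range.1 (hR hy)
  have key : ∀ a b : Fin n, (G.map Fin.valEmbedding).Adj (a : ℕ) (b : ℕ) ↔ G.Adj a b :=
    fun a b => SimpleGraph.map_adj_apply (f := Fin.valEmbedding)
  rw [key] at hcx hcy ⊢
  exact hs x (by simpa using hx) y (by simpa using hy) hcx hcy fun h => hxy (congrArg _ h)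

theorem isDeletionSet_iff (q : ℕ) (S : Finset (Fin n)) :
    IsDeletionSet (InducedFree (SimpleGraph.completeGraph (Fin (q + 1)))) G S ↔
      CliquesLE (G.map Fin.valEmbedding) q {x | ∃ i : Fin n, i ∉ S ∧ (i : ℕ) = x} := by
  have h0 : IsDeletionSet (InducedFree (SimpleGraph.completeGraph (Fin (q + 1)))) G S ↔
      (G.induce {v | v ∉ S}).CliqueFree (q + 1) := by
    rw [← not_not (a := SimpleGraph.CliqueFree _ _), SimpleGraph.not_cliqueFree_iff_top_isContained,
      ← SimpleGraph.top_isIndContained_iff_top_isContained]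
    rfl
  have key : ∀ a b : Fin n, (G.map Fin.valEmbedding).Adj (a : ℕ) (b : ℕ) ↔ G.Adj a b :=
    fun a b => SimpleGraph.map_adj_apply (f := Fin.valEmbedding)
  rw [h0]
  constructor
  · intro h t ht htc
    by_contra! hlt
    let t' : Finset {v // v ∉ S} := Finset.univ.filter fun i => (i.1 : ℕ) ∈ t
    have h1 : t.card ≤ t'.card := by
      refine (Finset.card_le_card fun x hx => ?_).trans
        (Finset.card_image_le (s := t') (f := fun i => (i.1 : ℕ)))
      obtain ⟨i, hi, rfl⟩ := ht hx
      exact Finset.mem_image.2 ⟨⟨i, hi⟩, by simpa [t'] using hx, rfl⟩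
    refine h.mono (Nat.succ_le_of_lt (hlt.trans_le h1)) t' ⟨fun x hx y hy hxy => ?_, rfl⟩
    have hx : (x.1 : ℕ) ∈ t := by simpa [t'] using hx
    have hy : (y.1 : ℕ) ∈ t := by simpa [t'] using hy
    exact (key _ _).1 (htc hx hy fun h => hxy (Subtype.ext (Fin.ext h)))
  · intro h t ht
    let f : {v // v ∈ ({v | v ∉ S} : Set (Fin n))} ↪ ℕ :=
      (Function.Embedding.subtype _).trans Fin.valEmbedding
    have := h (t.map f) ?_ ?_
    · rw [Finset.card_map, ht.card_eq] at this
      omega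
    · intro x hx
      obtain ⟨i, -, rfl⟩ := Finset.mem_map.1 hx
      exact ⟨i.1, i.2, rfl⟩
    · intro x hx y hy hxy
      obtain ⟨i, hi, rfl⟩ := Finset.mem_map.1 hx
      obtain ⟨j, hj, rfl⟩ := Finset.mem_map.1 hy
      exact (key _ _).2 (ht.isClique hi hj fun h => hxy (by rw [h]))

/-- The vertices outside of the set that the elimination algorithm finds. -/
noncomputable def deletionSet (q : ℕ) : Finset (Fin n) :=
  Finset.univ.filter fun i : Fin n => (i : ℕ) ∉ solve (adjOf (encodeGraph G, n)) q n

theorem encodeVertexSet_deletionSet (q : ℕ) :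
    encodeVertexSet (deletionSet G q) = deletionWord q (encodeGraph G) := by
  rw [deletionWord, dimOf_eq (length_encodeGraph G), ← List.map_coe_finRange_eq_range,
    List.map_map, encodeVertexSet]
  refine List.map_congr_left fun i _ => ?_
  rw [Bool.eq_iff_iff]
  simp [deletionSet]

theorem isMinimumDeletionSet_deletionSet {G : SimpleGraph (Fin n)} (hG : Chordal G) (q : ℕ) :
    IsMinimumDeletionSet (InducedFree (SimpleGraph.completeGraph (Fin (q + 1)))) G
      (deletionSet G q) := by
  have hsol := isBestExtension_solve (q := q) (adjOf_encodeGraph G) (exists_simplicial_map hG)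
  have hcard : ∀ T : Finset (Fin n), T.card + Tᶜ.card = n := fun T => by
    rw [Finset.card_add_card_compl, Fintype.card_fin]
  constructor
  · rw [isDeletionSet_iff]
    refine hsol.cliquesLE.mono ?_
    rintro x ⟨i, hi, rfl⟩
    right
    simpa [deletionSet] using hi
  · intro T hT
    rw [isDeletionSet_iff] at hT
    have h1 := hsol.le (Tᶜ.map Fin.valEmbedding) (fun x hx => by
      obtain ⟨i, -, rfl⟩ := Finset.mem_map.1 hx
      simp) (hT.mono fun x hx => by
      obtain ⟨i, hi, rfl⟩ := Finset.mem_map.1 hx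
      exact ⟨i, by simpa using hi, rfl⟩) (by simp)
    have h2 : (solve (adjOf (encodeGraph G, n)) q n).length ≤ (deletionSet G q)ᶜ.card := by
      rw [← List.toFinset_card_of_nodup hsol.nodup, ← Finset.card_map Fin.valEmbedding]
      refine Finset.card_le_card fun x hx => ?_
      rw [List.mem_toFinset] at hx
      exact Finset.mem_map.2 ⟨⟨x, Finset.mem_range.1 (hsol.mem x hx).1⟩,
        by simpa [deletionSet] using hx, rfl⟩
    simp only [List.not_mem_nil, not_false_eq_true, Finset.filter_true, Finset.card_map] at h1
    have h3 := hcard T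
    have h4 := hcard (deletionSet G q)
    omega

end VertexDeletion

theorem mainTheorem8 (p : ℕ) (hp : 1 < p) :
    VertexDeletion.DeletionProblemInP VertexDeletion.Chordal
      (VertexDeletion.InducedFree (SimpleGraph.completeGraph (Fin p))) := by
  obtain ⟨q, rfl⟩ : ∃ q, p = q + 1 := ⟨p - 1, by omega⟩
  exact ⟨fun x => VertexDeletion.deletionSet x.graph q,
    fun x => VertexDeletion.isMinimumDeletionSet_deletionSet x.mem q,
    (VertexDeletion.polyTime_deletionWord q).computable fun x =>
      VertexDeletion.encodeVertexSet_deletionSet x.graph q⟩
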